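/- Let $n\in\mathbb{N}$. For a nonempty polytope $P\subset\mathbb{R}^n$ (the convex hull of a nonempty finite set) and $\alpha\in\mathbb{R}^n$ (identified with $(\mathbb{R}^n)^*$ by the standard inner product) let $F_\alpha(P)=\{p\in P : \langle\alpha,p-x\rangle\ge 0\ \forall x\in P\}$; these sets are the faces of $P$. The normal cone of a face $F$ is $N(P,F)=\{\alpha : F\subseteq F_\alpha(P)\}$, and the normal fan $\mathcal{N}(P)$ is the collection of the normal cones of all faces of $P$. A fan $\Sigma'$ refines a fan $\Sigma$ if every cone of $\Sigma'$ is contained in some cone of $\Sigma$. A Delzant polytope is a full-dimensional polytope $P\subset\mathbb{R}^n$ whose normal fan is unimodular, i.e. every cone $C\in\mathcal{N}(P)$ is generated by linearly independent integer vectors that form a $\mathbb{Z}$-basis of the lattice $\mathbb{R}C\cap\mathbb{Z}^n$. Let $\mathcal{D}(n)$ be the space of all Delzant polytopes in $\mathbb{R}^n$, with the topology induced by the Hausdorff distance. A path $\gamma:[0,1]\to\mathcal{D}(n)$ is locally refining if for every $t_0\in[0,1]$ there is an $\varepsilon>0$ such that $\mathcal{N}(\gamma(t))$ refines $\mathcal{N}(\gamma(t_0))$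 for every $t\in[0,1]$ with $|t-t_0|\le\varepsilon$. It has finite complexity if only finitely many distinct normal fans occur among the polytopes $\gamma(t)$, $t\in[0,1]$. **Theorem.** Every locally refining loop $\gamma$ in $\mathcal{D}(n)$ is null-homotopic (homotopic, relative to its endpoints, to the constant loop at its base point). Moreover, every loop of finite complexity in $\mathcal{D}(n)$ is locally refining; in particular, loops of finite complexity are null-homotopic. -/

import Mathlib

open scoped unitInterval
open TopologicalSpace

/-- `ℝⁿ` with its Euclidean norm. The dual space is identified with `ℝⁿ` through the standard
inner product, so that normal cones and normal fans live in `ℝⁿ` too. -/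
abbrev EucSp (n : ℕ) : Type := EuclideanSpace ℝ (Fin n)

/-- A convex polytope: the convex hull of a finite nonempty set of points. -/
def IsPolytope {n : ℕ} (P : Set (EucSp n)) : Prop :=
  ∃ S : Finset (EucSp n), S.Nonempty ∧ P = convexHull ℝ (S : Set (EucSp n))

/-- The face `F_α(P) = {p ∈ P | ⟨α, p - x⟩ ≥ 0 for all x ∈ P}` of `P` in the direction `α`. -/
def faceDir {n : ℕ} (P : Set (EucSp n)) (α : EucSp n) : Set (EucSp n) :=
  {p | p ∈ P ∧ ∀ x ∈ P, 0 ≤ inner ℝ α (p - x)}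

/-- `F` is a face of `P`: it is the face of `P` in some direction (possibly `0`, giving `P`). -/
def IsFaceOf {n : ℕ} (P F : Set (EucSp n)) : Prop :=
  ∃ α : EucSp n, F = faceDir P α

/-- The normal cone `N(P, F) = {α | F ⊆ F_α(P)}`. -/
def normalConeAt {n : ℕ} (P F : Set (EucSp n)) : Set (EucSp n) :=
  {α | F ⊆ faceDir P α}

/-- The normal fan of `P`: the collection of the normal cones of all its faces. -/
def normalFan {n : ℕ} (P : Set (EucSp n)) : Set (Set (EucSp n)) :=
  {C | ∃ F : Set (EucSp n), IsFaceOf P F ∧ C = normalConeAt P F}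

/-- The fan `S'` refines the fan `S`: every cone of `S'` is contained in some cone of `S`. -/
def FanRefines {n : ℕ} (S' S : Set (Set (EucSp n))) : Prop :=
  ∀ C' ∈ S', ∃ C ∈ S, C' ⊆ C

/-- The integer vector `z ∈ ℤⁿ`, as a point of `ℝⁿ`. -/
def intVec {n : ℕ} (z : Fin n → ℤ) : EucSp n :=
  WithLp.toLp 2 (fun i => (z i : ℝ))

/-- A rational simplicial cone of multiplicity one: it is generated by linearly independent
integer vectors `v₁, …, vₘ` which generate the whole lattice `ℝC ∩ ℤⁿ` of integer points of its
linear span. (Such `vᵢ` are automatically primitive, being part of a lattice basis.) -/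
def IsUnimodularCone {n : ℕ} (C : Set (EucSp n)) : Prop :=
  ∃ (m : ℕ) (v : Fin m → Fin n → ℤ),
    LinearIndependent ℝ (fun i => intVec (v i)) ∧
    C = (PointedCone.hull ℝ (Set.range fun i => intVec (v i)) : Set (EucSp n)) ∧
    ∀ z : Fin n → ℤ, intVec z ∈ Submodule.span ℝ C →
      z ∈ Submodule.span ℤ (Set.range v)

/-- A Delzant polytope: a full-dimensional polytope whose normal fan is unimodular, that is,
all of its cones are rational, simplicial and of multiplicity one. (The normal fan of a polytope
is complete, so it is automatically a full-dimensional fan.) -/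
structure IsDelzant {n : ℕ} (P : Set (EucSp n)) : Prop where
  isPolytope : IsPolytope P
  fullDim : affineSpan ℝ P = ⊤
  unimodular : ∀ C ∈ normalFan P, IsUnimodularCone C

/-- The space `𝒟(n)` of Delzant `n`-polytopes. Its topology is the one induced by the Hausdorff
distance, which is Mathlib's metric on `NonemptyCompacts`. -/
abbrev DelzantSpace (n : ℕ) : Type :=
  {K : NonemptyCompacts (EucSp n) // IsDelzant (K : Set (EucSp n))}

/-- The normal fan of a point of `𝒟(n)`. -/
def DelzantSpace.fan {n : ℕ} (P : DelzantSpace n) : Set (Set (EucSp n)) :=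
  normalFan ((P : NonemptyCompacts (EucSp n)) : Set (EucSp n))

/-- A path `γ` in `𝒟(n)` is locally refining if for every `t₀ ∈ [0,1]` there is an `ε > 0` such
that the fan of `γ(t)` refines that of `γ(t₀)` whenever `|t - t₀| ≤ ε`. -/
def IsLocallyRefining {n : ℕ} {P Q : DelzantSpace n} (γ : Path P Q) : Prop :=
  ∀ t₀ : I, ∃ ε : ℝ, 0 < ε ∧
    ∀ t : I, |(t : ℝ) - (t₀ : ℝ)| ≤ ε → FanRefines (γ t).fan (γ t₀).fan

/-- A path in `𝒟(n)` has finite complexity if only finitely many normal fans arise along it. -/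
def HasFiniteComplexity {n : ℕ} {P Q : DelzantSpace n} (γ : Path P Q) : Prop :=
  (Set.range fun t : I => (γ t).fan).Finite

/-!
If `L` refines `K`, every Minkowski combination `(1 - s) K + s L` with `s > 0` has the normal fan
of `L`, so it is again Delzant. Consequently the Delzant polytopes refining a given `C`, those
refined by a given `R`, and those doing both when `R` refines `C`, are star-shaped for Minkowski
combinations about `C`, `R` and `R`, hence simply connected. A locally refining path is a
concatenation of pieces each of which consists of refinements of one of its points `Cₖ`. If `R`
refines all the `Cₖ` and all the division points, every piece can be replaced by a homotopic one
refined by `R`, so the path can be deformed into the simply connected space of Delzant polytopes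
refined by `R`. For two locally refining paths one common `R` can be used.

The common refinement `R` of finitely many Delzant polytopes is obtained from the cube by cutting
off faces of codimension two parallel to themselves, which subdivides the normal fan at the sum
`u + w` of two rays spanning a cone, and preserves smoothness. Each cone of the given fans is cut
out by integral linear forms, and suitably chosen subdivisions make one form after the other keep
a constant sign on every cone.

For a path of finite complexity, being refined by a fixed fan is a closed condition on a polytope,
so each of the finitely many fans which does not refine the fan at time `t₀` is avoided near `t₀`.
-/

section SupportFunction

variable {E : Type*} [NormedAddCommGroup E] [InnerProductSpace ℝ E]

/-- The support function `α ↦ max {⟨α, x⟩ | x ∈ K}` of `K`, written as a supremum; it takes the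
junk value `0` where `⟨α, ·⟩` is unbounded above on `K`. -/
noncomputable def supportFun (K : Set E) (α : E) : ℝ :=
  sSup ((inner ℝ α ·) '' K)

theorem inner_le_supportFun {K : Set E} (hK : IsCompact K) (α : E) {x : E} (hx : x ∈ K) :
    inner ℝ α x ≤ supportFun K α :=
  le_csSup (hK.bddAbove_image (by fun_prop)) (Set.mem_image_of_mem _ hx)

theorem supportFun_le {K : Set E} (hK : K.Nonempty) {α : E} {c : ℝ}
    (h : ∀ x ∈ K, inner ℝ α x ≤ c) : supportFun K α ≤ c :=
  csSup_le (hK.image _) (Set.forall_mem_image.2 h)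

theorem exists_inner_eq_supportFun {K : Set E} (hK : IsCompact K) (hne : K.Nonempty) (α : E) :
    ∃ x ∈ K, inner ℝ α x = supportFun K α :=
  (hK.image_of_continuousOn (by fun_prop)).sSup_mem (hne.image _)

theorem supportFun_le_add_norm_mul_dist (K L : NonemptyCompacts E) (α : E) :
    supportFun (K : Set E) α ≤ supportFun (L : Set E) α + ‖α‖ * dist K L := by
  refine supportFun_le K.nonempty fun x hx => ?_
  obtain ⟨y, hy, hxy⟩ := L.isCompact.exists_infDist_eq_dist L.nonempty x
  have hdist : ‖x - y‖ ≤ dist K L := by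
    rw [← dist_eq_norm, ← hxy, Metric.NonemptyCompacts.dist_eq]
    exact Metric.infDist_le_hausdorffDist_of_mem hx
      (Metric.hausdorffEDist_ne_top_of_nonempty_of_bounded K.nonempty L.nonempty
        K.isCompact.isBounded L.isCompact.isBounded)
  calc inner ℝ α x = inner ℝ α y + inner ℝ α (x - y) := by rw [inner_sub_right]; ring
    _ ≤ supportFun (L : Set E) α + ‖α‖ * dist K L := by
        gcongr
        · exact inner_le_supportFun L.isCompact α hy
        · exact (real_inner_le_norm α (x - y)).trans (by gcongr)

theorem continuous_supportFun (α : E) :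
    Continuous fun K : NonemptyCompacts E => supportFun (K : Set E) α :=
  (LipschitzWith.of_le_add_mul ‖α‖₊ fun K L =>
    supportFun_le_add_norm_mul_dist K L α).continuous

end SupportFunction

section Faces

variable {n : ℕ} {P Q : Set (EucSp n)} {α β p : EucSp n}

theorem mem_faceDir_iff : p ∈ faceDir P α ↔ p ∈ P ∧ ∀ x ∈ P, inner ℝ α x ≤ inner ℝ α p := by
  simp only [faceDir, inner_sub_right, sub_nonneg, Set.mem_ofPred_eq]

theorem mem_faceDir_iff_inner_eq_supportFun (hP : IsCompact P) :
    p ∈ faceDir P α ↔ p ∈ P ∧ inner ℝ α p = supportFun P α := by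
  rw [mem_faceDir_iff, and_congr_right_iff]
  refine fun hp => ⟨fun h => ?_, fun h x hx => h ▸ inner_le_supportFun hP α hx⟩
  exact (inner_le_supportFun hP α hp).antisymm (supportFun_le ⟨p, hp⟩ h)

theorem faceDir_nonempty (hP : IsCompact P) (hne : P.Nonempty) (α : EucSp n) :
    (faceDir P α).Nonempty := by
  obtain ⟨p, hp, h⟩ := exists_inner_eq_supportFun hP hne α
  exact ⟨p, (mem_faceDir_iff_inner_eq_supportFun hP).2 ⟨hp, h⟩⟩

theorem convex_faceDir (hP : Convex ℝ P) (α : EucSp n) : Convex ℝ (faceDir P α) := by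
  have hface : faceDir P α = P ∩ ⋂ x ∈ P, {p | inner ℝ α x ≤ inner ℝ α p} := by
    ext p
    simp only [mem_faceDir_iff, Set.mem_inter_iff, Set.mem_iInter, Set.mem_ofPred_eq]
  rw [hface]
  exact hP.inter (convex_iInter₂ fun x _ =>
    convex_halfSpace_ge (innerₗ (EucSp n) α).isLinear (inner ℝ α x))

theorem faceDir_smul {c : ℝ} (hc : 0 < c) (P : Set (EucSp n)) (α : EucSp n) :
    faceDir P (c • α) = faceDir P α := by
  simp only [faceDir, real_inner_smul_left, mul_nonneg_iff_of_pos_left hc]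

theorem faceDir_add_subset (h : (faceDir P α ∩ faceDir P β).Nonempty) :
    faceDir P (α + β) ⊆ faceDir P α ∩ faceDir P β := by
  obtain ⟨q, hα, hβ⟩ := h
  rintro x hx
  rw [Set.mem_inter_iff]
  simp only [mem_faceDir_iff, inner_add_left] at hα hβ hx ⊢
  have hxq := hx.2 q hα.1
  have hαx := hα.2 x hx.1
  have hβx := hβ.2 x hx.1
  exact ⟨⟨hx.1, fun y hy => (hα.2 y hy).trans (by linarith)⟩,
    ⟨hx.1, fun y hy => (hβ.2 y hy).trans (by linarith)⟩⟩

theorem inter_faceDir_nonempty_iff_supportFun_add (hP : IsCompact P) (hne : P.Nonempty) :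
    (faceDir P α ∩ faceDir P β).Nonempty ↔
      supportFun P (α + β) = supportFun P α + supportFun P β := by
  simp only [Set.Nonempty, Set.mem_inter_iff, mem_faceDir_iff_inner_eq_supportFun hP]
  constructor
  · rintro ⟨p, ⟨hp, hα⟩, -, hβ⟩
    refine le_antisymm (supportFun_le hne fun x hx => ?_) ?_
    · rw [inner_add_left]
      exact add_le_add (inner_le_supportFun hP α hx) (inner_le_supportFun hP β hx)
    · rw [← hα, ← hβ, ← inner_add_left]
      exact inner_le_supportFun hP _ hp
  · intro h
    obtain ⟨p, hp, hpαβ⟩ := exists_inner_eq_supportFun hP hne (α + β)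
    rw [h, inner_add_left] at hpαβ
    have hα := inner_le_supportFun hP α hp
    have hβ := inner_le_supportFun hP β hp
    exact ⟨p, ⟨hp, by linarith⟩, hp, by linarith⟩

theorem mem_faceDir_of_mem_hull {V : Set (EucSp n)} (hp : p ∈ P) (hV : ∀ v ∈ V, p ∈ faceDir P v)
    (hβ : β ∈ PointedCone.hull ℝ V) : p ∈ faceDir P β := by
  refine ⟨hp, fun x hx => ?_⟩
  induction hβ using Submodule.span_induction with
  | mem v hv => exact (hV v hv).2 x hx
  | zero => rw [inner_zero_left]
  | add v w _ _ hv hw =>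
    rw [inner_add_left]
    exact add_nonneg hv hw
  | smul c v _ hv =>
    rw [← Nonneg.coe_smul, real_inner_smul_left]
    exact mul_nonneg c.2 hv

theorem normalFan_eq_range (P : Set (EucSp n)) :
    normalFan P = Set.range fun α => normalConeAt P (faceDir P α) := by
  ext C
  simp only [normalFan, IsFaceOf, Set.mem_ofPred_eq, Set.mem_range, eq_comm (a := C)]
  exact ⟨fun ⟨_, ⟨α, hF⟩, hC⟩ => ⟨α, hF ▸ hC⟩, fun ⟨α, hC⟩ => ⟨_, ⟨α, rfl⟩, hC⟩⟩

end Faces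

section Polytopes

variable {n : ℕ} {P Q : Set (EucSp n)} {α β : EucSp n}

theorem IsPolytope.isCompact (hP : IsPolytope P) : IsCompact P := by
  obtain ⟨S, -, rfl⟩ := hP
  exact S.finite_toSet.isCompact_convexHull ℝ

theorem IsPolytope.nonempty (hP : IsPolytope P) : P.Nonempty := by
  obtain ⟨S, hS, rfl⟩ := hP
  exact (S.coe_nonempty.2 hS).convexHull

theorem IsPolytope.faceDir_nonempty (hP : IsPolytope P) (α : EucSp n) : (faceDir P α).Nonempty :=
  _root_.faceDir_nonempty hP.isCompact hP.nonempty α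

theorem faceDir_convexHull (S : Finset (EucSp n)) (α : EucSp n) :
    faceDir (convexHull ℝ (S : Set (EucSp n))) α =
      convexHull ℝ (↑S ∩ faceDir (convexHull ℝ (S : Set (EucSp n))) α) := by
  classical
  set F := faceDir (convexHull ℝ (S : Set (EucSp n))) α
  refine Set.Subset.antisymm (fun x hx => ?_)
    (convexHull_min Set.inter_subset_right (convex_faceDir (convex_convexHull ℝ _) α))
  obtain ⟨w, hw, hw_sum, hwx⟩ := Finset.mem_convexHull'.1 hx.1
  have hgap : ∀ s ∈ S, 0 ≤ inner ℝ α (x - s) := fun s hs => hx.2 s (subset_convexHull ℝ _ hs)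
  have hgap_sum : ∑ s ∈ S, w s * inner ℝ α (x - s) = 0 := by
    simp only [← real_inner_smul_right, ← inner_sum, smul_sub, Finset.sum_sub_distrib,
      ← Finset.sum_smul, hw_sum, hwx, one_smul, sub_self, inner_zero_right]
  have hw_face : ∀ s ∈ S, w s ≠ 0 → s ∈ F := by
    intro s hs hws
    have hzero := (Finset.sum_eq_zero_iff_of_nonneg
      fun s hs => mul_nonneg (hw s hs) (hgap s hs)).1 hgap_sum s hs
    have hsx : inner ℝ α x = inner ℝ α s := by
      rw [← sub_eq_zero, ← inner_sub_right]
      exact (mul_eq_zero.1 hzero).resolve_left hws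
    exact mem_faceDir_iff.2 ⟨subset_convexHull ℝ _ hs, fun y hy =>
      hsx ▸ (mem_faceDir_iff.1 hx).2 y hy⟩
  rw [← hwx, ← Finset.sum_filter_of_ne (p := (· ∈ F))
    fun s hs h => hw_face s hs fun h0 => h (by rw [h0, zero_smul])]
  refine (convex_convexHull ℝ _).sum_mem (fun s hs => hw s (Finset.mem_filter.1 hs).1) ?_
    fun s hs => subset_convexHull ℝ _ (Finset.mem_filter.1 hs)
  rwa [Finset.sum_filter_of_ne hw_face]

theorem IsPolytope.finite_normalFan (hP : IsPolytope P) : (normalFan P).Finite := by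
  obtain ⟨S, -, rfl⟩ := hP
  refine (S.finite_toSet.finite_subsets.image fun T =>
    normalConeAt (convexHull ℝ (S : Set (EucSp n))) (convexHull ℝ T)).subset ?_
  rw [normalFan_eq_range, Set.range_subset_iff]
  exact fun α => ⟨↑S ∩ faceDir _ α, Set.inter_subset_left, by dsimp only; rw [← faceDir_convexHull]⟩

theorem IsPolytope.exists_mem_faceDir_smul_sub (hP : IsPolytope P)
    (h : faceDir P α ⊆ faceDir P β) {p : EucSp n} (hp : p ∈ faceDir P α) :
    ∃ N : ℝ, 0 < N ∧ p ∈ faceDir P (N • α - β) := by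
  obtain ⟨S, -, rfl⟩ := hP
  have hgen : ∀ s ∈ S, ∀ᶠ N : ℝ in Filter.atTop,
      inner ℝ (N • α - β) s ≤ inner ℝ (N • α - β) p := by
    intro s hs
    have hsP := subset_convexHull ℝ (S : Set (EucSp n)) hs
    simp only [inner_sub_left, real_inner_smul_left]
    rcases ((mem_faceDir_iff.1 hp).2 s hsP).eq_or_lt with heq | hlt
    · have hsα : s ∈ faceDir (convexHull ℝ (S : Set (EucSp n))) α :=
        mem_faceDir_iff.2 ⟨hsP, fun x hx => heq ▸ (mem_faceDir_iff.1 hp).2 x hx⟩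
      have := (mem_faceDir_iff.1 (h hsα)).2 p hp.1
      filter_upwards with N
      rw [heq]
      linarith
    · filter_upwards [Filter.eventually_ge_atTop
        ((inner ℝ β p - inner ℝ β s) / (inner ℝ α p - inner ℝ α s))] with N hN
      rw [div_le_iff₀ (sub_pos.2 hlt)] at hN
      linarith
  obtain ⟨N, hN, hN0⟩ := (((Filter.eventually_all_finset S).2 hgen).and
    (Filter.eventually_gt_atTop 0)).exists
  have hhalf : convexHull ℝ (S : Set (EucSp n)) ⊆
      {x | inner ℝ (N • α - β) x ≤ inner ℝ (N • α - β) p} :=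
    convexHull_min hN (convex_halfSpace_le (innerₗ (EucSp n) (N • α - β)).isLinear _)
  exact ⟨N, hN0, mem_faceDir_iff.2 ⟨hp.1, hhalf⟩⟩

end Polytopes

section DirRefines

variable {n : ℕ} {P Q R : Set (EucSp n)} {α β : EucSp n}

/-- Refinement of normal fans expressed through directions: any two directions maximized at a
common point of `Q` are maximized at a common point of `P`. For polytopes this is equivalent to
`FanRefines (normalFan Q) (normalFan P)`, and unlike the latter it is visibly a closed condition
on `P` and compatible with Minkowski sums. -/
def DirRefines (Q P : Set (EucSp n)) : Prop :=
  ∀ ⦃α β : EucSp n⦄,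
    (faceDir Q α ∩ faceDir Q β).Nonempty → (faceDir P α ∩ faceDir P β).Nonempty

theorem DirRefines.refl (P : Set (EucSp n)) : DirRefines P P := fun _ _ h => h

theorem DirRefines.trans (hRQ : DirRefines R Q) (hQP : DirRefines Q P) : DirRefines R P :=
  fun _ _ h => hQP (hRQ h)

theorem DirRefines.faceDir_subset (hQ : IsPolytope Q) (h : DirRefines Q P)
    (hαβ : faceDir Q α ⊆ faceDir Q β) : faceDir P α ⊆ faceDir P β := by
  obtain ⟨q, hq⟩ := hQ.faceDir_nonempty α
  obtain ⟨N, hN, hqN⟩ := hQ.exists_mem_faceDir_smul_sub hαβ hq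
  have hP := faceDir_add_subset (h ⟨q, hαβ hq, hqN⟩)
  rw [add_sub_cancel, faceDir_smul hN] at hP
  exact hP.trans Set.inter_subset_left

theorem fanRefines_normalFan_iff_dirRefines (hQ : IsPolytope Q) (hP : IsPolytope P) :
    FanRefines (normalFan Q) (normalFan P) ↔ DirRefines Q P := by
  constructor
  · intro h α β hne
    obtain ⟨_, ⟨_, ⟨δ, rfl⟩, rfl⟩, hcone⟩ := h _ ⟨_, ⟨α + β, rfl⟩, rfl⟩
    obtain ⟨p, hp⟩ := hP.faceDir_nonempty δ
    have hsum := faceDir_add_subset hne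
    exact ⟨p, hcone (hsum.trans Set.inter_subset_left) hp,
      hcone (hsum.trans Set.inter_subset_right) hp⟩
  · rintro h _ ⟨_, ⟨α, rfl⟩, rfl⟩
    exact ⟨_, ⟨_, ⟨α, rfl⟩, rfl⟩, fun β hβ => h.faceDir_subset hQ hβ⟩

theorem isClosed_setOf_dirRefines (Q : Set (EucSp n)) :
    IsClosed {K : NonemptyCompacts (EucSp n) | DirRefines Q K} := by
  simp only [DirRefines, inter_faceDir_nonempty_iff_supportFun_add (NonemptyCompacts.isCompact _)
    (NonemptyCompacts.nonempty _), Set.ofPred_forall]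
  exact isClosed_iInter fun α => isClosed_iInter fun β => isClosed_iInter fun _ =>
    isClosed_eq (continuous_supportFun _)
      ((continuous_supportFun α).add (continuous_supportFun β))

end DirRefines

section MinkowskiSum

open scoped Pointwise

variable {n : ℕ} {P Q R : Set (EucSp n)} {α : EucSp n}

theorem add_mem_faceDir_add_iff {p q : EucSp n} (hp : p ∈ P) (hq : q ∈ Q) :
    p + q ∈ faceDir (P + Q) α ↔ p ∈ faceDir P α ∧ q ∈ faceDir Q α := by
  simp only [mem_faceDir_iff, Set.add_mem_add hp hq, hp, hq, true_and]
  rw [← Set.image2_add, Set.forall_mem_image2]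
  simp only [inner_add_right]
  exact ⟨fun h => ⟨fun x hx => by linarith [h x hx q hq], fun y hy => by linarith [h p hp y hy]⟩,
    fun h x hx y hy => add_le_add (h.1 x hx) (h.2 y hy)⟩

theorem smul_mem_faceDir_smul_set {c : ℝ} (hc : 0 ≤ c) {p : EucSp n} (hp : p ∈ faceDir P α) :
    c • p ∈ faceDir (c • P) α := by
  rw [mem_faceDir_iff] at hp ⊢
  refine ⟨Set.smul_mem_smul_set hp.1, ?_⟩
  rintro _ ⟨x, hx, rfl⟩
  simpa only [real_inner_smul_right] using mul_le_mul_of_nonneg_left (hp.2 x hx) hc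

theorem faceDir_smul_set {c : ℝ} (hc : 0 < c) (P : Set (EucSp n)) (α : EucSp n) :
    faceDir (c • P) α = c • faceDir P α := by
  refine Set.Subset.antisymm (fun x hx => ?_) ?_
  · have := smul_mem_faceDir_smul_set (inv_nonneg.2 hc.le) hx
    rw [inv_smul_smul₀ hc.ne'] at this
    exact (Set.mem_smul_set_iff_inv_smul_mem₀ hc.ne' _ _).2 this
  · rintro _ ⟨p, hp, rfl⟩
    exact smul_mem_faceDir_smul_set hc.le hp

theorem normalFan_smul_set {c : ℝ} (hc : 0 < c) (P : Set (EucSp n)) :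
    normalFan (c • P) = normalFan P := by
  simp only [normalFan_eq_range, normalConeAt, faceDir_smul_set hc,
    Set.smul_set_subset_smul_set_iff₀ hc.ne']

theorem DirRefines.add (hP : DirRefines R P) (hQ : DirRefines R Q) : DirRefines R (P + Q) := by
  intro α β h
  obtain ⟨p, hpα, hpβ⟩ := hP h
  obtain ⟨q, hqα, hqβ⟩ := hQ h
  exact ⟨p + q, (add_mem_faceDir_add_iff hpα.1 hqα.1).2 ⟨hpα, hqα⟩,
    (add_mem_faceDir_add_iff hpβ.1 hqβ.1).2 ⟨hpβ, hqβ⟩⟩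

theorem dirRefines_add_right (P Q : Set (EucSp n)) : DirRefines (P + Q) Q := by
  rintro α β ⟨_, hα, hβ⟩
  obtain ⟨p, hp, q, hq, rfl⟩ := hα.1
  rw [add_mem_faceDir_add_iff hp hq] at hα hβ
  exact ⟨q, hα.2, hβ.2⟩

theorem DirRefines.smul_set (h : DirRefines R P) {c : ℝ} (hc : 0 ≤ c) : DirRefines R (c • P) := by
  intro α β hR
  obtain ⟨p, hα, hβ⟩ := h hR
  exact ⟨c • p, smul_mem_faceDir_smul_set hc hα, smul_mem_faceDir_smul_set hc hβ⟩

theorem dirRefines_smul_set_left_iff {c : ℝ} (hc : 0 < c) :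
    DirRefines (c • R) P ↔ DirRefines R P := by
  simp only [DirRefines, faceDir_smul_set hc, ← Set.smul_set_inter₀ hc.ne', Set.smul_set_nonempty]

theorem IsPolytope.smul_set (hP : IsPolytope P) (c : ℝ) : IsPolytope (c • P) := by
  classical
  obtain ⟨S, hS, rfl⟩ := hP
  exact ⟨S.image (c • ·), hS.image _, by
    rw [Finset.coe_image, Set.image_smul, convexHull_smul]⟩

theorem IsPolytope.add (hP : IsPolytope P) (hQ : IsPolytope Q) : IsPolytope (P + Q) := by
  classical
  obtain ⟨S, hS, rfl⟩ := hP
  obtain ⟨T, hT, rfl⟩ := hQ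
  exact ⟨S + T, hS.add hT, by rw [Finset.coe_add, convexHull_add]⟩

theorem IsDelzant.smul_set (hP : IsDelzant P) {c : ℝ} (hc : 0 < c) : IsDelzant (c • P) where
  isPolytope := hP.isPolytope.smul_set c
  fullDim := by
    rw [← AffineSubspace.smul_span, hP.fullDim, AffineSubspace.smul_top hc.ne'.isUnit]
  unimodular := normalFan_smul_set hc P ▸ hP.unimodular

theorem normalFan_add_eq_right (hP : IsPolytope P) (hQ : IsPolytope Q) (h : DirRefines Q P) :
    normalFan (P + Q) = normalFan Q := by
  rw [normalFan_eq_range, normalFan_eq_range]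
  refine congrArg Set.range (funext fun α => Set.ext fun β => ⟨fun hβ q hq => ?_, fun hβ => ?_⟩)
  · obtain ⟨p, hp⟩ := hP.faceDir_nonempty α
    exact ((add_mem_faceDir_add_iff hp.1 hq.1).1
      (hβ ((add_mem_faceDir_add_iff hp.1 hq.1).2 ⟨hp, hq⟩))).2
  · rintro _ hz
    obtain ⟨p, hp, q, hq, rfl⟩ := hz.1
    rw [add_mem_faceDir_add_iff hp hq] at hz ⊢
    exact ⟨h.faceDir_subset hQ hβ hz.1, hβ hz.2⟩

theorem IsDelzant.add_left (hP : IsPolytope P) (hQ : IsDelzant Q) (h : DirRefines Q P) :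
    IsDelzant (P + Q) where
  isPolytope := hP.add hQ.isPolytope
  fullDim := by
    obtain ⟨p, hp⟩ := hP.nonempty
    refine top_le_iff.1 ?_
    rw [← AffineSubspace.pointwise_vadd_top p, ← hQ.fullDim, AffineSubspace.pointwise_vadd_span]
    exact affineSpan_mono ℝ (Set.vadd_set_subset_vadd hp)
  unimodular := normalFan_add_eq_right hP hQ.isPolytope h ▸ hQ.unimodular

end MinkowskiSum

section BasisCone

variable {R V ι : Type*} [Ring R] [PartialOrder R] [IsOrderedRing R] [AddCommGroup V] [Module R V]

theorem mem_hull_basis_image_iff (b : Module.Basis ι R V) (J : Set ι) {x : V} :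
    x ∈ PointedCone.hull R (b '' J) ↔ (∀ i, 0 ≤ b.repr x i) ∧ ∀ i ∉ J, b.repr x i = 0 := by
  classical
  constructor
  · intro hx
    rw [← forall_and]
    intro i
    induction hx using Submodule.span_induction with
    | mem y hy =>
      obtain ⟨j, hj, rfl⟩ := hy
      rw [b.repr_self, Finsupp.single_apply]
      split_ifs with hji
      · exact ⟨zero_le_one, fun hi => absurd (hji ▸ hj) hi⟩
      · exact ⟨le_rfl, fun _ => rfl⟩
    | zero => simp only [map_zero, Finsupp.coe_zero, Pi.zero_apply, le_refl, implies_true, and_self]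
    | add y z _ _ hy hz =>
      rw [map_add, Finsupp.add_apply]
      exact ⟨add_nonneg hy.1 hz.1, fun hi => by rw [hy.2 hi, hz.2 hi, add_zero]⟩
    | smul c y _ hy =>
      rw [← Nonneg.coe_smul, map_smul, Finsupp.smul_apply, smul_eq_mul]
      exact ⟨mul_nonneg c.2 hy.1, fun hi => by rw [hy.2 hi, mul_zero]⟩
  · rintro ⟨hnonneg, hzero⟩
    rw [← b.linearCombination_repr x, Finsupp.linearCombination_apply]
    refine Submodule.sum_mem _ fun i hi => ?_
    have hiJ : i ∈ J := by_contra fun h => Finsupp.mem_support_iff.1 hi (hzero i h)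
    have hbi : b i ∈ PointedCone.hull R (b '' J) := Submodule.subset_span ⟨i, hiJ, rfl⟩
    exact Submodule.smul_mem _ (⟨b.repr x i, hnonneg i⟩ : {c : R // 0 ≤ c}) hbi

end BasisCone

section Lattice

variable {n : ℕ} {ι : Type*}

/-- `intVec` as a `ℤ`-linear map. -/
def intVecLinear (n : ℕ) : (Fin n → ℤ) →ₗ[ℤ] EucSp n where
  toFun := intVec
  map_add' u v := by ext; simp [intVec]
  map_smul' k u := by ext; simp [intVec]

theorem intVec_add (u v : Fin n → ℤ) : intVec (u + v) = intVec u + intVec v :=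
  (intVecLinear n).map_add u v

theorem intVec_sum (s : Finset ι) (f : ι → Fin n → ℤ) :
    intVec (∑ i ∈ s, f i) = ∑ i ∈ s, intVec (f i) :=
  map_sum (intVecLinear n) f s

theorem intVec_smul (k : ℤ) (u : Fin n → ℤ) : intVec (k • u) = (k : ℝ) • intVec u :=
  ((intVecLinear n).map_smul k u).trans (Int.cast_smul_eq_zsmul ℝ k _).symm

theorem intVec_single (k : Fin n) : intVec (Pi.single k 1) = EuclideanSpace.single k (1 : ℝ) := by
  ext i
  simp [intVec, Pi.single_apply]

theorem span_range_intVec : Submodule.span ℝ (Set.range (intVec (n := n))) = ⊤ := by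
  rw [← top_le_iff, ← (EuclideanSpace.basisFun (Fin n) ℝ).toBasis.span_eq]
  refine Submodule.span_mono ?_
  rintro _ ⟨k, rfl⟩
  exact ⟨Pi.single k 1, by simp [intVec_single]⟩

/-- The vector of `ℝⁿ` representing a functional on the lattice `ℤⁿ` through the inner product. -/
def dualVec (φ : Module.Dual ℤ (Fin n → ℤ)) : EucSp n :=
  intVec fun k => φ (Pi.single k 1)

theorem inner_dualVec_intVec (φ : Module.Dual ℤ (Fin n → ℤ)) (z : Fin n → ℤ) :
    inner ℝ (dualVec φ) (intVec z) = (φ z : ℝ) := by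
  have hsingle (k : Fin n) : (fun j => if k = j then (1 : ℤ) else 0) = Pi.single k 1 :=
    funext fun j => by simp only [Pi.single_apply, eq_comm]
  simp [φ.pi_apply_eq_sum_univ z, hsingle, dualVec, intVec, PiLp.inner_apply]

theorem dualVec_neg (φ : Module.Dual ℤ (Fin n → ℤ)) : dualVec (-φ) = -dualVec φ :=
  (intVecLinear n).map_neg _

variable (b : Module.Basis ι ℤ (Fin n → ℤ))

theorem linearIndependent_intVec_comp_basis : LinearIndependent ℝ (intVec ∘ b) := by
  classical
  refine linearIndependent_iff'.2 fun s g hg i hi => ?_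
  have hcoord := congrArg (inner ℝ (dualVec (b.coord i))) hg
  simpa [inner_sum, real_inner_smul_right, inner_dualVec_intVec, Finsupp.single_apply, hi]
    using hcoord

theorem span_range_intVec_comp_basis : Submodule.span ℝ (Set.range (intVec ∘ b)) = ⊤ := by
  rw [← top_le_iff, ← span_range_intVec, Submodule.span_le]
  rintro _ ⟨z, rfl⟩
  rw [← b.linearCombination_repr z, Finsupp.linearCombination_apply, Finsupp.sum, intVec_sum]
  refine Submodule.sum_mem _ fun i _ => ?_
  rw [intVec_smul]
  exact Submodule.smul_mem _ _ (Submodule.subset_span ⟨i, rfl⟩)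

/-- A basis of the lattice `ℤⁿ`, as a basis of `ℝⁿ`. -/
noncomputable def intVecBasis : Module.Basis ι ℝ (EucSp n) :=
  .mk (linearIndependent_intVec_comp_basis b) (span_range_intVec_comp_basis b).ge

theorem intVecBasis_apply (i : ι) : intVecBasis b i = intVec (b i) :=
  Module.Basis.mk_apply _ _ i

theorem intVecBasis_repr (x : EucSp n) (i : ι) :
    (intVecBasis b).repr x i = inner ℝ (dualVec (b.coord i)) x := by
  classical
  refine LinearMap.congr_fun (f := (intVecBasis b).coord i)
    (g := innerₗ (EucSp n) (dualVec (b.coord i))) ((intVecBasis b).ext fun j => ?_) x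
  rw [innerₗ_apply_apply, Module.Basis.coord_apply, Module.Basis.repr_self, intVecBasis_apply,
    inner_dualVec_intVec, Module.Basis.coord_apply, Module.Basis.repr_self,
    Finsupp.single_apply, Finsupp.single_apply, Int.cast_ite, Int.cast_one, Int.cast_zero]

theorem intVecBasis_repr_intVec (z : Fin n → ℤ) (i : ι) :
    (intVecBasis b).repr (intVec z) i = (b.repr z i : ℝ) := by
  rw [intVecBasis_repr, inner_dualVec_intVec, Module.Basis.coord_apply]

end Lattice

section UnimodularCones

variable {n : ℕ} {C : Set (EucSp n)}

theorem exists_basis_extending {ι : Type*} {v : ι → Fin n → ℤ}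
    (hli : LinearIndependent ℝ (intVec ∘ v))
    (hsat : ∀ z, intVec z ∈ Submodule.span ℝ (Set.range (intVec ∘ v)) →
      z ∈ Submodule.span ℤ (Set.range v)) :
    ∃ (b : Module.Basis (Fin n) ℤ (Fin n → ℤ)) (f : ι → Fin n), b ∘ f = v := by
  set W := Submodule.span ℤ (Set.range v) with hW
  have hliZ : LinearIndependent ℤ v :=
    (hli.restrict_scalars' ℤ).of_comp (intVecLinear n)
  have hmem : ∀ z ∈ W, intVec z ∈ Submodule.span ℝ (Set.range (intVec ∘ v)) := by
    intro z hz
    have := Submodule.mem_map_of_mem (f := intVecLinear n) hz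
    rw [hW, Submodule.map_span, ← Set.range_comp] at this
    exact Submodule.span_le_restrictScalars ℤ ℝ _ this
  have htf : Module.IsTorsionFree ℤ ((Fin n → ℤ) ⧸ W) := by
    refine .of_smul_eq_zero fun k z hz => or_iff_not_imp_left.2 fun hk => ?_
    obtain ⟨z, rfl⟩ := W.mkQ_surjective z
    rw [← map_smul, Submodule.mkQ_apply, Submodule.Quotient.mk_eq_zero] at hz
    rw [Submodule.mkQ_apply, Submodule.Quotient.mk_eq_zero]
    have hkz := hmem _ hz
    rw [intVec_smul, Submodule.smul_mem_iff _ (Int.cast_ne_zero.2 hk)] at hkz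
    exact hsat z hkz
  let b := (Module.Basis.span hliZ).sumQuot (Module.Free.chooseBasis ℤ ((Fin n → ℤ) ⧸ W))
  let e := b.indexEquiv (Pi.basisFun ℤ (Fin n))
  refine ⟨b.reindex e, e ∘ Sum.inl, funext fun i => ?_⟩
  rw [Function.comp_apply, Function.comp_apply, Module.Basis.reindex_apply, e.symm_apply_apply,
    Module.Basis.sumQuot_inl, Module.Basis.span_apply]

theorem span_hull_eq_span (S : Set (EucSp n)) :
    Submodule.span ℝ (PointedCone.hull ℝ S : Set (EucSp n)) = Submodule.span ℝ S :=
  Submodule.span_span_of_tower _ _ _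

theorem isUnimodularCone_hull_of_basis (b : Module.Basis (Fin n) ℤ (Fin n → ℤ))
    (J : Set (Fin n)) :
    IsUnimodularCone (PointedCone.hull ℝ (intVecBasis b '' J) : Set (EucSp n)) := by
  classical
  let e : Fin (Fintype.card J) ≃ J := (Fintype.equivFin J).symm
  have hrange : ∀ {M : Type} (f : Fin n → M), Set.range (fun k => f (e k)) = f '' J := by
    intro M f
    rw [Set.image_eq_range, ← e.surjective.range_comp]
    rfl
  refine ⟨Fintype.card J, fun k => b (e k), ?_, ?_, fun z hz => ?_⟩
  · exact (linearIndependent_intVec_comp_basis b).comp _ (Subtype.val_injective.comp e.injective)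
  · simp only [← intVecBasis_apply, hrange]
  · rw [span_hull_eq_span, Module.Basis.mem_span_image] at hz
    rw [hrange, Module.Basis.mem_span_image]
    intro i hi
    refine hz ?_
    simpa [intVecBasis_repr_intVec] using hi

theorem isUnimodularCone_iff_exists_basis :
    IsUnimodularCone C ↔ ∃ (b : Module.Basis (Fin n) ℤ (Fin n → ℤ)) (J : Set (Fin n)),
      C = PointedCone.hull ℝ (intVecBasis b '' J) := by
  constructor
  · rintro ⟨m, v, hli, rfl, hsat⟩
    rw [span_hull_eq_span] at hsat
    obtain ⟨b, f, rfl⟩ := exists_basis_extending hli hsat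
    refine ⟨b, Set.range f, ?_⟩
    simp only [← Set.range_comp, Function.comp_def, intVecBasis_apply]
  · rintro ⟨b, J, rfl⟩
    exact isUnimodularCone_hull_of_basis b J

theorem IsUnimodularCone.exists_eq_setOf_dualVec (hC : IsUnimodularCone C) :
    ∃ T : Finset (Module.Dual ℤ (Fin n → ℤ)), C = {α | ∀ φ ∈ T, 0 ≤ inner ℝ (dualVec φ) α} := by
  classical
  obtain ⟨b, J, rfl⟩ := isUnimodularCone_iff_exists_basis.1 hC
  refine ⟨Finset.univ.image b.coord ∪ (Finset.univ.filter (· ∉ J)).image (-b.coord ·), ?_⟩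
  ext α
  simp only [SetLike.mem_coe, mem_hull_basis_image_iff, intVecBasis_repr, Set.mem_ofPred_eq,
    Finset.forall_mem_union, Finset.forall_mem_image, Finset.mem_univ, Finset.mem_filter, true_and,
    forall_const, dualVec_neg, inner_neg_left, Left.nonneg_neg_iff]
  exact and_congr_right fun h => forall₂_congr fun i _ => (h i).ge_iff_eq'.symm

end UnimodularCones

section UnimodularFamilies

variable {R M ι : Type*} [CommRing R] [AddCommGroup M] [Module R M]

theorem exists_basis_insert_add_subset {b : Module.Basis ι R M} {u w : M} (hu : u ∈ Set.range b)
    (hw : w ∈ Set.range b) (huw : u ≠ w) :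
    ∃ b' : Module.Basis ι R M, insert (u + w) (Set.range b \ {u}) ⊆ Set.range b' := by
  obtain ⟨i, rfl⟩ := hu
  obtain ⟨j, rfl⟩ := hw
  have hij : i ≠ j := fun h => huw (congrArg b h)
  have hcoord : b.coord i (b j) = 0 := by simp [hij.symm]
  refine ⟨b.map (LinearEquiv.transvection hcoord), Set.insert_subset ⟨i, ?_⟩ ?_⟩
  · simp [LinearEquiv.transvection, LinearMap.transvection.apply]
  · rintro _ ⟨⟨k, rfl⟩, hk⟩
    have hki : k ≠ i := fun h => hk (congrArg b h)
    exact ⟨k, by simp [LinearEquiv.transvection, LinearMap.transvection.apply, hki]⟩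

/-- A family of subsets of a lattice is unimodular if each of them is part of a lattice basis,
indexed by `ι`. The members of the family stand for the sets of generators of the cones of a fan. -/
def IsUnimodularFamily (ι : Type*) {M : Type*} [AddCommGroup M] (Δ : Set (Set M)) : Prop :=
  ∀ S ∈ Δ, ∃ b : Module.Basis ι ℤ M, S ⊆ Set.range b

end UnimodularFamilies

section StellarSubdivisions

variable {M ι : Type*} [AddCommGroup M] {Δ Δ' : Set (Set M)} {u w : M} {φ : Module.Dual ℤ M}

/-- `Δ'` arises from the family `Δ` of sets of cone generators by subdividing all cones that contain
the two-dimensional cone spanned by `u` and `w` along the new ray through `u + w`. Only the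
properties of such a subdivision that bound `Δ'` from above are recorded. -/
def IsStellarSubdivision (Δ' Δ : Set (Set M)) (u w : M) : Prop :=
  ∀ S ∈ Δ', ¬ (u ∈ S ∧ w ∈ S) ∧ ∃ T ∈ Δ, S ⊆ T ∨ u ∈ T ∧ w ∈ T ∧ S ⊆ insert (u + w) T

/-- The pairs of generators of a common cone which are strictly separated by the hyperplane
`φ = 0`. Such a pair exists iff this hyperplane cuts through the relative interior of a cone. -/
def separatedPairs (Δ : Set (Set M)) (φ : Module.Dual ℤ M) : Set (M × M) :=
  {p | (∃ S ∈ Δ, p.1 ∈ S ∧ p.2 ∈ S) ∧ 0 < φ p.1 ∧ φ p.2 < 0}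

theorem finite_separatedPairs (hΔ : (⋃₀ Δ).Finite) (φ : Module.Dual ℤ M) :
    (separatedPairs Δ φ).Finite :=
  (hΔ.prod hΔ).subset fun _ ⟨⟨S, hS, h₁, h₂⟩, _⟩ => ⟨⟨S, hS, h₁⟩, ⟨S, hS, h₂⟩⟩

namespace IsStellarSubdivision

theorem symm (h : IsStellarSubdivision Δ' Δ u w) : IsStellarSubdivision Δ' Δ w u := by
  simpa only [IsStellarSubdivision, and_comm, and_left_comm, and_assoc, add_comm] using h

theorem isUnimodularFamily (h : IsStellarSubdivision Δ' Δ u w) (huw : u ≠ w)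
    (hΔ : IsUnimodularFamily ι Δ) : IsUnimodularFamily ι Δ' := by
  intro S hS
  obtain ⟨hnot, T, hT, hST | ⟨hu, hw, hST⟩⟩ := h S hS
  · exact (hΔ T hT).imp fun _ hb => hST.trans hb
  · obtain ⟨b, hb⟩ := hΔ T hT
    wlog huS : u ∉ S generalizing u w
    · refine this h.symm huw.symm (by rwa [and_comm]) hw hu (add_comm u w ▸ hST) fun hwS => ?_
      exact hnot ⟨not_not.1 huS, hwS⟩
    obtain ⟨b', hb'⟩ := exists_basis_insert_add_subset (hb hu) (hb hw) huw
    refine ⟨b', fun v hv => hb' ((hST hv).imp_right fun hvT => ⟨hb hvT, ?_⟩)⟩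
    exact fun hvu => huS (Set.mem_singleton_iff.1 hvu ▸ hv)

theorem mem_separatedPairs_or (h : IsStellarSubdivision Δ' Δ u w) {p : M × M}
    (hp : p ∈ separatedPairs Δ' φ) :
    p ∈ separatedPairs Δ φ ∨ ∃ T ∈ Δ, u ∈ T ∧ w ∈ T ∧
      (p.1 = u + w ∧ p.2 ∈ T ∨ p.1 ∈ T ∧ p.2 = u + w) := by
  obtain ⟨⟨S, hS, h₁, h₂⟩, hpos, hneg⟩ := hp
  obtain ⟨-, T, hT, hST | ⟨hu, hw, hST⟩⟩ := h S hS
  · exact Or.inl ⟨⟨T, hT, hST h₁, hST h₂⟩, hpos, hneg⟩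
  · rcases hST h₁ with e₁ | h₁ <;> rcases hST h₂ with e₂ | h₂
    · exact absurd hpos (e₁.trans e₂.symm ▸ hneg.not_gt)
    · exact Or.inr ⟨T, hT, hu, hw, Or.inl ⟨e₁, h₂⟩⟩
    · exact Or.inr ⟨T, hT, hu, hw, Or.inr ⟨h₁, e₂⟩⟩
    · exact Or.inl ⟨⟨T, hT, h₁, h₂⟩, hpos, hneg⟩

theorem separatedPairs_eq_empty (h : IsStellarSubdivision Δ' Δ u w)
    (hΔ : separatedPairs Δ φ = ∅) : separatedPairs Δ' φ = ∅ := by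
  rw [Set.eq_empty_iff_forall_notMem] at hΔ ⊢
  rintro ⟨a, b⟩ hab
  rcases h.mem_separatedPairs_or hab with hab' | ⟨T, hT, hu, hw, ⟨rfl, hb⟩ | ⟨ha, rfl⟩⟩
  · exact hΔ _ hab'
  · have hφu : ¬ 0 < φ u := fun hφ => hΔ (u, b) ⟨⟨T, hT, hu, hb⟩, hφ, hab.2.2⟩
    have hφw : ¬ 0 < φ w := fun hφ => hΔ (w, b) ⟨⟨T, hT, hw, hb⟩, hφ, hab.2.2⟩
    have hφadd := hab.2.1
    rw [map_add] at hφadd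
    omega
  · have hφu : ¬ φ u < 0 := fun hφ => hΔ (a, u) ⟨⟨T, hT, ha, hu⟩, hab.2.1, hφ⟩
    have hφw : ¬ φ w < 0 := fun hφ => hΔ (a, w) ⟨⟨T, hT, ha, hw⟩, hab.2.1, hφ⟩
    have hφadd := hab.2.2
    rw [map_add] at hφadd
    omega

theorem mem_separatedPairs_or_lt (h : IsStellarSubdivision Δ' Δ u w)
    (huw : (u, w) ∈ separatedPairs Δ φ)
    (hmax : ∀ p ∈ separatedPairs Δ φ, φ p.1 - φ p.2 ≤ φ u - φ w) {p : M × M}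
    (hp : p ∈ separatedPairs Δ' φ) : p ∈ separatedPairs Δ φ ∨ φ p.1 - φ p.2 < φ u - φ w := by
  obtain ⟨-, hφu, hφw⟩ := huw
  obtain ⟨a, b⟩ := p
  dsimp only at hφu hφw ⊢
  refine (h.mem_separatedPairs_or hp).imp_right ?_
  rintro ⟨T, hT, hu, hw, ⟨rfl, hb⟩ | ⟨ha, rfl⟩⟩
  · have hle := hmax (u, b) ⟨⟨T, hT, hu, hb⟩, hφu, hp.2.2⟩
    dsimp only at hle
    rw [map_add]
    omega
  · have hle := hmax (a, w) ⟨⟨T, hT, ha, hw⟩, hp.2.1, hφw⟩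
    dsimp only at hle
    rw [map_add]
    omega

theorem notMem_separatedPairs (h : IsStellarSubdivision Δ' Δ u w) :
    (u, w) ∉ separatedPairs Δ' φ :=
  fun ⟨⟨S, hS, hmem⟩, _⟩ => (h S hS).1 hmem

end IsStellarSubdivision

/-- A class of families of finite sets of cone generators in which every two-dimensional cone can
be subdivided. -/
structure IsStellarClass (𝒞 : Set (Set (Set M))) : Prop where
  finite_sUnion : ∀ Δ ∈ 𝒞, (⋃₀ Δ).Finite
  exists_isStellarSubdivision : ∀ Δ ∈ 𝒞, ∀ S ∈ Δ, ∀ u ∈ S, ∀ w ∈ S, u ≠ w →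
    ∃ Δ' ∈ 𝒞, IsStellarSubdivision Δ' Δ u w

namespace IsStellarClass

variable {𝒞 : Set (Set (Set M))}

theorem sep_separatedPairs_eq_empty (h𝒞 : IsStellarClass 𝒞) (φ : Module.Dual ℤ M) :
    IsStellarClass {Δ ∈ 𝒞 | separatedPairs Δ φ = ∅} where
  finite_sUnion Δ hΔ := h𝒞.finite_sUnion Δ hΔ.1
  exists_isStellarSubdivision Δ hΔ S hS u hu w hw huw := by
    obtain ⟨Δ', hΔ', h⟩ := h𝒞.exists_isStellarSubdivision Δ hΔ.1 S hS u hu w hw huw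
    exact ⟨Δ', ⟨hΔ', h.separatedPairs_eq_empty hΔ.2⟩, h⟩

theorem exists_separatedPairs_gap_ssubset (h𝒞 : IsStellarClass 𝒞) (hΔ : Δ ∈ 𝒞) {N : ℤ}
    (hgap : ∀ p ∈ separatedPairs Δ φ, φ p.1 - φ p.2 ≤ N) {p : M × M}
    (hp : p ∈ separatedPairs Δ φ) (hpN : φ p.1 - φ p.2 = N) :
    ∃ Δ' ∈ 𝒞, (∀ q ∈ separatedPairs Δ' φ, φ q.1 - φ q.2 ≤ N) ∧
      {q ∈ separatedPairs Δ' φ | φ q.1 - φ q.2 = N} ⊂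
        {q ∈ separatedPairs Δ φ | φ q.1 - φ q.2 = N} := by
  obtain ⟨⟨S, hS, hu, hw⟩, hφu, hφw⟩ := id hp
  have hne : p.1 ≠ p.2 := fun h => hφw.not_gt (h ▸ hφu)
  obtain ⟨Δ', hΔ', hsub⟩ := h𝒞.exists_isStellarSubdivision Δ hΔ S hS _ hu _ hw hne
  have hnew {q : M × M} (hq : q ∈ separatedPairs Δ' φ) :
      q ∈ separatedPairs Δ φ ∨ φ q.1 - φ q.2 < N :=
    hpN ▸ hsub.mem_separatedPairs_or_lt hp (fun r hr => (hgap r hr).trans hpN.ge) hq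
  refine ⟨Δ', hΔ', fun q hq => (hnew hq).elim (hgap q) le_of_lt, fun q hq => ?_, fun h => ?_⟩
  · exact ⟨(hnew hq.1).resolve_right hq.2.not_lt, hq.2⟩
  · exact hsub.notMem_separatedPairs (h ⟨hp, hpN⟩).1

theorem exists_separatedPairs_eq_empty (h𝒞 : IsStellarClass 𝒞) (hne : 𝒞.Nonempty)
    (φ : Module.Dual ℤ M) : ∃ Δ ∈ 𝒞, separatedPairs Δ φ = ∅ := by
  have hbdd : ∃ N : ℕ, ∃ Δ ∈ 𝒞, ∀ p ∈ separatedPairs Δ φ, φ p.1 - φ p.2 ≤ N := by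
    obtain ⟨Δ, hΔ⟩ := hne
    obtain ⟨B, hB⟩ := ((finite_separatedPairs (h𝒞.finite_sUnion Δ hΔ) φ).image
      fun p => φ p.1 - φ p.2).bddAbove
    exact ⟨B.toNat, Δ, hΔ, fun p hp => (hB ⟨p, hp, rfl⟩).trans (Int.self_le_toNat B)⟩
  -- The least possible maximal gap `φ u - φ w` of a separated pair `(u, w)`, and a family in
  -- which it is attained by the fewest pairs.
  obtain ⟨N, hex, hN⟩ := exists_minimal_of_wellFoundedLT _ hbdd
  obtain ⟨Δ, ⟨hΔ, hgap⟩, hmin⟩ := exists_minimalFor_of_wellFoundedLT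
    (fun Δ => Δ ∈ 𝒞 ∧ ∀ p ∈ separatedPairs Δ φ, φ p.1 - φ p.2 ≤ N)
    (fun Δ => {p ∈ separatedPairs Δ φ | φ p.1 - φ p.2 = N}.ncard) hex
  refine ⟨Δ, hΔ, Set.eq_empty_of_forall_notMem fun p hp => ?_⟩
  obtain ⟨q, hq, hqN⟩ : ∃ q ∈ separatedPairs Δ φ, φ q.1 - φ q.2 = N := by
    by_contra! hlt
    have hlt : ∀ q ∈ separatedPairs Δ φ, φ q.1 - φ q.2 < N := fun q hq =>
      (hgap q hq).lt_of_ne (hlt q hq)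
    have hpos : 0 < N := by have := hlt p hp; have := hp.2; omega
    have := hN (y := N - 1) ⟨Δ, hΔ, fun q hq => by have := hlt q hq; omega⟩ (by omega)
    omega
  obtain ⟨Δ', hΔ', hgap', hssub⟩ := h𝒞.exists_separatedPairs_gap_ssubset hΔ hgap hq hqN
  have hfin := finite_separatedPairs (h𝒞.finite_sUnion Δ hΔ) φ
  have hcard := Set.ncard_lt_ncard hssub (hfin.subset (Set.sep_subset _ _))
  exact hcard.not_ge (hmin ⟨hΔ', hgap'⟩ hcard.le)

theorem exists_forall_separatedPairs_eq_empty (h𝒞 : IsStellarClass 𝒞) (hne : 𝒞.Nonempty)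
    (T : Finset (Module.Dual ℤ M)) : ∃ Δ ∈ 𝒞, ∀ φ ∈ T, separatedPairs Δ φ = ∅ := by
  classical
  induction T using Finset.induction_on generalizing 𝒞 with
  | empty => exact hne.imp fun Δ hΔ => ⟨hΔ, fun φ hφ => absurd hφ (Finset.notMem_empty φ)⟩
  | insert φ T _ ih =>
    obtain ⟨Δ, ⟨hΔ, hφ⟩, hT⟩ := ih (h𝒞.sep_separatedPairs_eq_empty φ)
      (h𝒞.exists_separatedPairs_eq_empty hne φ)
    exact ⟨Δ, hΔ, Finset.forall_mem_insert _ _ _ |>.2 ⟨hφ, hT⟩⟩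

end IsStellarClass

end StellarSubdivisions

section Polyhedra

variable {n : ℕ}

/-- The polyhedron of all `x` with `⟨v, x⟩ ≤ c` for every `(v, c)` in a finite set of pairs, with
integral normals `v`. -/
def polyhedron (A : Finset ((Fin n → ℤ) × ℝ)) : Set (EucSp n) :=
  {x | ∀ a ∈ A, inner ℝ (intVec a.1) x ≤ a.2}

/-- The normals of the inequalities of `A` that are equalities at `x`. -/
def tightNormals (A : Finset ((Fin n → ℤ) × ℝ)) (x : EucSp n) : Set (Fin n → ℤ) :=
  {v | (v, inner ℝ (intVec v) x) ∈ A}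

/-- The sets of normals that are tight at the points of the polyhedron. When every facet is defined
by one inequality, these sets generate the cones of the normal fan. -/
def tightSets (A : Finset ((Fin n → ℤ) × ℝ)) : Set (Set (Fin n → ℤ)) :=
  tightNormals A '' polyhedron A

variable {A : Finset ((Fin n → ℤ) × ℝ)} {x y d β : EucSp n} {u v : Fin n → ℤ}

theorem polyhedron_eq_iInter (A : Finset ((Fin n → ℤ) × ℝ)) :
    polyhedron A = ⋂ a ∈ A, {x | inner ℝ (intVec a.1) x ≤ a.2} := by
  ext x
  simp only [polyhedron, Set.mem_iInter, Set.mem_ofPred_eq]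

theorem isClosed_polyhedron (A : Finset ((Fin n → ℤ) × ℝ)) : IsClosed (polyhedron A) := by
  rw [polyhedron_eq_iInter]
  exact isClosed_biInter fun a _ => isClosed_le (by fun_prop) continuous_const

theorem convex_polyhedron (A : Finset ((Fin n → ℤ) × ℝ)) : Convex ℝ (polyhedron A) := by
  rw [polyhedron_eq_iInter]
  exact convex_iInter₂ fun a _ => convex_halfSpace_le (innerₗ (EucSp n) (intVec a.1)).isLinear a.2

theorem tightNormals_subset_image_fst (A : Finset ((Fin n → ℤ) × ℝ)) (x : EucSp n) :
    tightNormals A x ⊆ Prod.fst '' (A : Set ((Fin n → ℤ) × ℝ)) :=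
  fun _ hv => ⟨_, hv, rfl⟩

theorem finite_tightNormals (A : Finset ((Fin n → ℤ) × ℝ)) (x : EucSp n) :
    (tightNormals A x).Finite :=
  (A.finite_toSet.image _).subset (tightNormals_subset_image_fst A x)

theorem finite_tightSets (A : Finset ((Fin n → ℤ) × ℝ)) : (tightSets A).Finite := by
  refine (A.finite_toSet.image Prod.fst).finite_subsets.subset ?_
  rintro _ ⟨x, -, rfl⟩
  exact tightNormals_subset_image_fst A x

theorem mem_tightNormals_of_le (hx : x ∈ polyhedron A) (hv : v ∈ tightNormals A y)
    (h : inner ℝ (intVec v) y ≤ inner ℝ (intVec v) x) : v ∈ tightNormals A x := by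
  rwa [tightNormals, Set.mem_ofPred_eq, ← h.antisymm (hx _ hv)]

theorem inner_eq_of_mem_tightNormals (hx : x ∈ polyhedron A) (hy : y ∈ polyhedron A)
    (hvx : v ∈ tightNormals A x) (hvy : v ∈ tightNormals A y) :
    inner ℝ (intVec v) x = inner ℝ (intVec v) y :=
  (hx _ hvy).antisymm (hy _ hvx)

theorem mem_faceDir_of_mem_tightNormals (hx : x ∈ polyhedron A) (hv : v ∈ tightNormals A x) :
    x ∈ faceDir (polyhedron A) (intVec v) :=
  mem_faceDir_iff.2 ⟨hx, fun _ hy => hy _ hv⟩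

theorem tightNormals_midpoint_subset (hx : x ∈ polyhedron A) (hy : y ∈ polyhedron A) :
    tightNormals A (midpoint ℝ x y) ⊆ tightNormals A x ∩ tightNormals A y := by
  intro v hv
  have hmid : inner ℝ (intVec v) (midpoint ℝ x y) =
      2⁻¹ * (inner ℝ (intVec v) x + inner ℝ (intVec v) y) := by
    rw [midpoint_eq_smul_add, invOf_eq_inv, real_inner_smul_right, inner_add_right]
  have hvx : inner ℝ (intVec v) x ≤ inner ℝ (intVec v) (midpoint ℝ x y) := hx _ hv
  have hvy : inner ℝ (intVec v) y ≤ inner ℝ (intVec v) (midpoint ℝ x y) := hy _ hv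
  exact ⟨mem_tightNormals_of_le hx hv (by linarith), mem_tightNormals_of_le hy hv (by linarith)⟩

theorem exists_forall_tightNormals_subset {F : Set (EucSp n)} (hF : Convex ℝ F)
    (hne : F.Nonempty) (hFA : F ⊆ polyhedron A) :
    ∃ x ∈ F, ∀ y ∈ F, tightNormals A x ⊆ tightNormals A y := by
  obtain ⟨_, ⟨x, hx, rfl⟩, hmin⟩ :=
    ((finite_tightSets A).subset (Set.image_mono hFA)).exists_minimal (hne.image (tightNormals A))
  refine ⟨x, hx, fun y hy => ?_⟩
  have hsub := tightNormals_midpoint_subset (hFA hx) (hFA hy)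
  have hmid : midpoint ℝ x y ∈ F := hF.midpoint_mem hx hy
  exact (hmin ⟨_, hmid, rfl⟩ (hsub.trans Set.inter_subset_left)).trans
    (hsub.trans Set.inter_subset_right)

theorem eventually_add_smul_mem_polyhedron (hx : x ∈ polyhedron A)
    (hd : ∀ v ∈ tightNormals A x, inner ℝ (intVec v) d ≤ 0) :
    ∀ᶠ ε : ℝ in nhdsWithin 0 (Set.Ioi 0), x + ε • d ∈ polyhedron A := by
  refine (Filter.eventually_all_finset A).2 fun a ha => ?_
  rcases (hx a ha).eq_or_lt with htight | hslack
  · have had : inner ℝ (intVec a.1) d ≤ 0 :=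
      hd a.1 (by rw [tightNormals, Set.mem_ofPred_eq, htight]; exact ha)
    filter_upwards [self_mem_nhdsWithin] with ε hε
    rw [inner_add_right, real_inner_smul_right, htight]
    exact add_le_of_nonpos_right (mul_nonpos_of_nonneg_of_nonpos (le_of_lt hε) had)
  · have hcont : Continuous fun ε : ℝ => inner ℝ (intVec a.1) (x + ε • d) := by fun_prop
    have hnhds := hcont.tendsto' 0 _ (by rw [zero_smul, add_zero])
    exact (hnhds.mono_left nhdsWithin_le_nhds).eventually_le_const hslack

theorem eq_of_mem_extremePoints_polyhedron (hx : x ∈ (polyhedron A).extremePoints ℝ)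
    (hy : y ∈ polyhedron A) (h : tightNormals A x ⊆ tightNormals A y) : x = y := by
  have hzero : ∀ v ∈ tightNormals A x, inner ℝ (intVec v) (y - x) = 0 := fun v hv => by
    rw [inner_sub_right, inner_eq_of_mem_tightNormals hx.1 hy hv (h hv), sub_self]
  have hforward := eventually_add_smul_mem_polyhedron hx.1 fun v hv => (hzero v hv).le
  have hbackward := eventually_add_smul_mem_polyhedron (d := -(y - x)) hx.1 fun v hv => by
    rw [inner_neg_right, hzero v hv, neg_zero]
  obtain ⟨ε, ⟨hεf, hεb⟩, hε⟩ := ((hforward.and hbackward).and self_mem_nhdsWithin).exists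
  have hmem : x ∈ openSegment ℝ (x + ε • (y - x)) (x + ε • -(y - x)) :=
    ⟨1 / 2, 1 / 2, by norm_num, by norm_num, by norm_num, by module⟩
  have hfix : ε • (y - x) = 0 := add_eq_left.1 (hx.2 hεf hεb hmem)
  exact (sub_eq_zero.1 ((smul_eq_zero.1 hfix).resolve_left (ne_of_gt hε))).symm

theorem isPolytope_polyhedron (hb : Bornology.IsBounded (polyhedron A))
    (hne : (polyhedron A).Nonempty) : IsPolytope (polyhedron A) := by
  have hcompact := Metric.isCompact_of_isClosed_isBounded (isClosed_polyhedron A) hb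
  have hfin : ((polyhedron A).extremePoints ℝ).Finite := by
    refine Set.Finite.of_finite_image (f := tightNormals A)
      ((finite_tightSets A).subset (Set.image_mono extremePoints_subset)) ?_
    exact fun x hx y hy hxy => eq_of_mem_extremePoints_polyhedron hx hy.1 hxy.subset
  refine ⟨hfin.toFinset, ?_, ?_⟩
  · exact hfin.toFinset_nonempty.2 (hcompact.extremePoints_nonempty hne)
  · rw [hfin.coe_toFinset, ← (hfin.isClosed_convexHull ℝ).closure_eq,
      closure_convexHull_extremePoints hcompact (convex_polyhedron A)]

theorem inner_nonpos_of_mem_faceDir_polyhedron (hx : x ∈ faceDir (polyhedron A) β)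
    (hd : ∀ v ∈ tightNormals A x, inner ℝ (intVec v) d ≤ 0) : inner ℝ d β ≤ 0 := by
  rw [mem_faceDir_iff] at hx
  obtain ⟨ε, hmem, hε⟩ :=
    ((eventually_add_smul_mem_polyhedron hx.1 hd).and self_mem_nhdsWithin).exists
  have hle := hx.2 _ hmem
  rw [inner_add_right, real_inner_smul_right, add_le_iff_nonpos_right] at hle
  rw [real_inner_comm]
  exact (mul_nonpos_iff_pos_imp_nonpos.1 hle).1 hε

theorem image_intVec_eq_image_intVecBasis {ι : Type*} {b : Module.Basis ι ℤ (Fin n → ℤ)}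
    {S : Set (Fin n → ℤ)} (hS : S ⊆ Set.range b) :
    intVec '' S = intVecBasis b '' (b ⁻¹' S) := by
  conv_lhs => rw [← Set.image_preimage_eq_of_subset hS, Set.image_image]
  simp only [intVecBasis_apply]

theorem mem_faceDir_polyhedron_iff {ι : Type*} {b : Module.Basis ι ℤ (Fin n → ℤ)}
    (hx : x ∈ polyhedron A) (hb : tightNormals A x ⊆ Set.range b) :
    x ∈ faceDir (polyhedron A) β ↔ β ∈ PointedCone.hull ℝ (intVec '' tightNormals A x) := by
  classical
  refine ⟨fun hβ => ?_, mem_faceDir_of_mem_hull hx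
    (Set.forall_mem_image.2 fun v hv => mem_faceDir_of_mem_tightNormals hx hv)⟩
  rw [image_intVec_eq_image_intVecBasis hb, mem_hull_basis_image_iff]
  simp only [intVecBasis_repr]
  have hnonneg (i : ι) : 0 ≤ inner ℝ (dualVec (b.coord i)) β := by
    rw [← neg_nonpos, ← inner_neg_left]
    refine inner_nonpos_of_mem_faceDir_polyhedron hβ fun v hv => ?_
    obtain ⟨j, rfl⟩ := hb hv
    rw [inner_neg_right, real_inner_comm, inner_dualVec_intVec, neg_nonpos, b.coord_apply,
      b.repr_self, Finsupp.single_apply]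
    split_ifs <;> simp
  refine ⟨hnonneg, fun i hi => (inner_nonpos_of_mem_faceDir_polyhedron hβ ?_).antisymm (hnonneg i)⟩
  intro v hv
  obtain ⟨j, rfl⟩ := hb hv
  have hij : j ≠ i := by rintro rfl; exact hi hv
  rw [real_inner_comm, inner_dualVec_intVec]
  simp [hij]

end Polyhedra

section SmoothSystems

variable {n : ℕ}

/-- A system of inequalities which defines a Delzant polytope: it is bounded, strictly feasible,
and the normals that are tight at any feasible point are part of a lattice basis. -/
structure IsSmoothSystem (A : Finset ((Fin n → ℤ) × ℝ)) : Prop where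
  isBounded : Bornology.IsBounded (polyhedron A)
  exists_forall_lt : ∃ x, ∀ a ∈ A, inner ℝ (intVec a.1) x < a.2
  isUnimodularFamily : IsUnimodularFamily (Fin n) (tightSets A)

namespace IsSmoothSystem

variable {A : Finset ((Fin n → ℤ) × ℝ)} {x β : EucSp n}

theorem isCompact (hA : IsSmoothSystem A) : IsCompact (polyhedron A) :=
  Metric.isCompact_of_isClosed_isBounded (isClosed_polyhedron A) hA.isBounded

theorem isPolytope (hA : IsSmoothSystem A) : IsPolytope (polyhedron A) :=
  isPolytope_polyhedron hA.isBounded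
    (hA.exists_forall_lt.imp fun _ hx a ha => (hx a ha).le)

theorem mem_faceDir_iff (hA : IsSmoothSystem A) (hx : x ∈ polyhedron A) :
    x ∈ faceDir (polyhedron A) β ↔ β ∈ PointedCone.hull ℝ (intVec '' tightNormals A x) := by
  obtain ⟨b, hb⟩ := hA.isUnimodularFamily _ ⟨x, hx, rfl⟩
  exact mem_faceDir_polyhedron_iff hx hb

theorem affineSpan_eq_top (hA : IsSmoothSystem A) : affineSpan ℝ (polyhedron A) = ⊤ := by
  obtain ⟨x, hx⟩ := hA.exists_forall_lt
  have hopen : IsOpen (⋂ a ∈ A, {y : EucSp n | inner ℝ (intVec a.1) y < a.2}) :=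
    isOpen_biInter_finset fun a _ => isOpen_lt (by fun_prop) continuous_const
  rw [← top_le_iff, ← hopen.affineSpan_eq_top ⟨x, Set.mem_iInter₂.2 hx⟩, polyhedron_eq_iInter]
  exact affineSpan_mono ℝ (Set.iInter₂_mono fun a _ y (hy : inner ℝ (intVec a.1) y < a.2) =>
    Set.mem_ofPred.2 hy.le)

theorem normalConeAt_eq_hull (hA : IsSmoothSystem A) (α : EucSp n) :
    ∃ x ∈ polyhedron A, normalConeAt (polyhedron A) (faceDir (polyhedron A) α) =
      PointedCone.hull ℝ (intVec '' tightNormals A x) := by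
  obtain ⟨x, hx, hmin⟩ := exists_forall_tightNormals_subset
    (convex_faceDir (convex_polyhedron A) α) (hA.isPolytope.faceDir_nonempty α) fun _ hy => hy.1
  refine ⟨x, hx.1, Set.ext fun β => ⟨fun hβ => (hA.mem_faceDir_iff hx.1).1 (hβ hx),
    fun hβ y hy => (hA.mem_faceDir_iff hy.1).2 ?_⟩⟩
  exact Submodule.span_mono (Set.image_mono (hmin y hy)) hβ

theorem isDelzant (hA : IsSmoothSystem A) : IsDelzant (polyhedron A) where
  isPolytope := hA.isPolytope
  fullDim := hA.affineSpan_eq_top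
  unimodular := by
    rintro _ ⟨_, ⟨α, rfl⟩, rfl⟩
    obtain ⟨x, hx, hcone⟩ := hA.normalConeAt_eq_hull α
    obtain ⟨b, hb⟩ := hA.isUnimodularFamily _ ⟨x, hx, rfl⟩
    rw [hcone, image_intVec_eq_image_intVecBasis hb]
    exact isUnimodularCone_hull_of_basis b _

end IsSmoothSystem

end SmoothSystems

section FacetCutting

theorem eventually_exists_le_of_isCompact {X : Type*} [TopologicalSpace X] {K : Set X}
    (hK : IsCompact K) {f : X → ℝ} (hf : ContinuousOn f K) (h : ℝ) :
    ∀ᶠ c in nhdsWithin h (Set.Iio h), (∃ x ∈ K, c ≤ f x) → ∃ z ∈ K, h ≤ f z := by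
  by_cases hz : ∃ z ∈ K, h ≤ f z
  · exact Filter.Eventually.of_forall fun _ _ => hz
  rcases K.eq_empty_or_nonempty with rfl | hne
  · exact Filter.Eventually.of_forall fun _ ⟨x, hx, _⟩ => absurd hx (Set.notMem_empty x)
  obtain ⟨m, hm, hmax⟩ := hK.exists_isMaxOn hne hf
  have hmh : f m < h := not_le.1 fun hle => hz ⟨m, hm, hle⟩
  filter_upwards [Ioo_mem_nhdsLT hmh] with c hc ⟨x, hx, hcx⟩
  exact absurd (hcx.trans (hmax hx)) hc.1.not_ge

variable {n : ℕ} {A : Finset ((Fin n → ℤ) × ℝ)} {a : (Fin n → ℤ) × ℝ} {x y : EucSp n}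
  {u v w : Fin n → ℤ} {c : ℝ}

theorem isClosed_setOf_subset_tightNormals (S : Set (Fin n → ℤ)) :
    IsClosed {x | S ⊆ tightNormals A x} := by
  have hset : {x | S ⊆ tightNormals A x} =
      ⋂ v ∈ S, (fun x => (v, inner ℝ (intVec v) x)) ⁻¹' (A : Set ((Fin n → ℤ) × ℝ)) := by
    ext x
    simp only [Set.mem_iInter]
    rfl
  rw [hset]
  exact isClosed_biInter fun v _ => A.finite_toSet.isClosed.preimage (by fun_prop)

theorem eventually_exists_tightNormals_subset (hA : IsCompact (polyhedron A)) (α : EucSp n)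
    (h : ℝ) :
    ∀ᶠ c in nhdsWithin h (Set.Iio h), ∀ x ∈ polyhedron A, c ≤ inner ℝ α x →
      ∃ z ∈ polyhedron A, tightNormals A x ⊆ tightNormals A z ∧ h ≤ inner ℝ α z := by
  have hface : ∀ S ∈ tightSets A, ∀ᶠ c in nhdsWithin h (Set.Iio h),
      (∃ x ∈ polyhedron A ∩ {x | S ⊆ tightNormals A x}, c ≤ inner ℝ α x) →
        ∃ z ∈ polyhedron A ∩ {x | S ⊆ tightNormals A x}, h ≤ inner ℝ α z := fun S _ =>
    eventually_exists_le_of_isCompact (hA.inter_right (isClosed_setOf_subset_tightNormals S))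
      (by fun_prop) h
  filter_upwards [(Filter.eventually_all_finite (finite_tightSets A)).2 hface] with c hc x hx hcx
  obtain ⟨z, ⟨hz, hxz⟩, hhz⟩ := hc (tightNormals A x) ⟨x, hx, rfl⟩
    ⟨x, ⟨hx, Set.Subset.refl (tightNormals A x)⟩, hcx⟩
  exact ⟨z, hz, hxz, hhz⟩

theorem inner_intVec_add (u w : Fin n → ℤ) (x : EucSp n) :
    inner ℝ (intVec (u + w)) x = inner ℝ (intVec u) x + inner ℝ (intVec w) x := by
  rw [intVec_add, inner_add_left]

section Insert

variable [DecidableEq ((Fin n → ℤ) × ℝ)]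

theorem mem_polyhedron_insert_iff :
    x ∈ polyhedron (insert a A) ↔ inner ℝ (intVec a.1) x ≤ a.2 ∧ x ∈ polyhedron A :=
  Finset.forall_mem_insert _ _ _

theorem mem_tightNormals_insert_iff :
    v ∈ tightNormals (insert a A) x ↔
      v = a.1 ∧ inner ℝ (intVec a.1) x = a.2 ∨ v ∈ tightNormals A x := by
  rw [tightNormals, Set.mem_ofPred_eq, Finset.mem_insert, Prod.ext_iff]
  exact or_congr (and_congr_right fun h => h ▸ Iff.rfl) Iff.rfl

theorem isStellarSubdivision_tightSets_insert (hy : y ∈ polyhedron A)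
    (hu : u ∈ tightNormals A y) (hw : w ∈ tightNormals A y) (hu₀ : u ≠ 0) (hw₀ : w ≠ 0)
    (hc : c < inner ℝ (intVec (u + w)) y)
    (hface : ∀ x ∈ polyhedron A, c ≤ inner ℝ (intVec (u + w)) x → ∃ z ∈ polyhedron A,
      tightNormals A x ⊆ tightNormals A z ∧
        inner ℝ (intVec (u + w)) y ≤ inner ℝ (intVec (u + w)) z) :
    IsStellarSubdivision (tightSets (insert (u + w, c) A)) (tightSets A) u w := by
  rintro _ ⟨x, hx, rfl⟩
  obtain ⟨hxc, hxA⟩ := mem_polyhedron_insert_iff.1 hx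
  refine ⟨fun ⟨hux, hwx⟩ => ?_, ?_⟩
  · have hux := (mem_tightNormals_insert_iff.1 hux).resolve_left
      fun h => hw₀ (left_eq_add.1 h.1)
    have hwx := (mem_tightNormals_insert_iff.1 hwx).resolve_left
      fun h => hu₀ (right_eq_add.1 h.1)
    refine hxc.not_gt (hc.trans_eq ?_)
    rw [inner_intVec_add, inner_intVec_add, inner_eq_of_mem_tightNormals hxA hy hux hu,
      inner_eq_of_mem_tightNormals hxA hy hwx hw]
  · by_cases htight : inner ℝ (intVec (u + w)) x = c
    · obtain ⟨z, hz, hxz, hyz⟩ := hface x hxA htight.ge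
      rw [inner_intVec_add, inner_intVec_add] at hyz
      have huz : inner ℝ (intVec u) z ≤ inner ℝ (intVec u) y := hz _ hu
      have hwz : inner ℝ (intVec w) z ≤ inner ℝ (intVec w) y := hz _ hw
      refine ⟨_, ⟨z, hz, rfl⟩, Or.inr ⟨mem_tightNormals_of_le hz hu (by linarith),
        mem_tightNormals_of_le hz hw (by linarith), fun v hv => ?_⟩⟩
      exact (mem_tightNormals_insert_iff.1 hv).imp (fun h => h.1) fun h => hxz h
    · exact ⟨_, ⟨x, hxA, rfl⟩, Or.inl fun v hv =>
        (mem_tightNormals_insert_iff.1 hv).resolve_left fun h => htight h.2⟩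

end Insert

theorem IsSmoothSystem.exists_isStellarSubdivision (hA : IsSmoothSystem A)
    {S : Set (Fin n → ℤ)} (hS : S ∈ tightSets A) (hu : u ∈ S) (hw : w ∈ S) (huw : u ≠ w) :
    ∃ A', IsSmoothSystem A' ∧ IsStellarSubdivision (tightSets A') (tightSets A) u w := by
  classical
  obtain ⟨x₀, hx₀⟩ := hA.exists_forall_lt
  obtain ⟨b, hb⟩ := hA.isUnimodularFamily S hS
  have hne : ∀ v ∈ S, v ≠ 0 := fun v hv => by
    obtain ⟨i, rfl⟩ := hb hv
    exact b.ne_zero i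
  obtain ⟨y, hy, rfl⟩ := hS
  have hx₀y : inner ℝ (intVec (u + w)) x₀ < inner ℝ (intVec (u + w)) y := by
    rw [inner_intVec_add, inner_intVec_add]
    exact add_lt_add (hx₀ _ hu) (hx₀ _ hw)
  obtain ⟨c, hface, hcx₀, hcy⟩ := ((eventually_exists_tightNormals_subset hA.isCompact
    (intVec (u + w)) (inner ℝ (intVec (u + w)) y)).and (Ioo_mem_nhdsLT hx₀y)).exists
  have hsub := isStellarSubdivision_tightSets_insert hy hu hw (hne u hu) (hne w hw) hcy hface
  refine ⟨insert (u + w, c) A, ⟨?_, ⟨x₀, ?_⟩, ?_⟩, hsub⟩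
  · exact hA.isBounded.subset fun x hx => (mem_polyhedron_insert_iff.1 hx).2
  · exact (Finset.forall_mem_insert _ _ _).2 ⟨hcx₀, hx₀⟩
  · exact hsub.isUnimodularFamily huw hA.isUnimodularFamily

end FacetCutting

section Cube

variable {n : ℕ}

/-- The inequalities `± xᵢ ≤ 1` which define the cube `[-1, 1]ⁿ`. -/
noncomputable def cubeSystem (n : ℕ) : Finset ((Fin n → ℤ) × ℝ) :=
  open Classical in Finset.univ.image fun p : Fin n × ℤˣ => (Pi.single p.1 (p.2 : ℤ), 1)

theorem mem_cubeSystem_iff {a : (Fin n → ℤ) × ℝ} :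
    a ∈ cubeSystem n ↔ ∃ (i : Fin n) (s : ℤˣ), (Pi.single i (s : ℤ), 1) = a := by
  simp only [cubeSystem, Finset.mem_image, Finset.mem_univ, true_and, Prod.exists]

theorem inner_intVec_single (i : Fin n) (k : ℤ) (x : EucSp n) :
    inner ℝ (intVec (Pi.single i k)) x = k * x i := by
  have hsingle : (Pi.single i k : Fin n → ℤ) = k • Pi.single i 1 := by
    rw [← Pi.single_smul, smul_eq_mul, mul_one]
  rw [hsingle, intVec_smul, intVec_single, real_inner_smul_left, EuclideanSpace.inner_single_left,
    map_one, one_mul]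

theorem isBounded_polyhedron_cubeSystem : Bornology.IsBounded (polyhedron (cubeSystem n)) := by
  have hball : Bornology.IsBounded
      ((WithLp.ofLp : EucSp n → Fin n → ℝ) ⁻¹' Metric.closedBall 0 1) :=
    (PiLp.antilipschitzWith_ofLp 2 _).isBounded_preimage Metric.isBounded_closedBall
  refine hball.subset fun x hx => ?_
  have hle (i : Fin n) (s : ℤˣ) : ((s : ℤ) : ℝ) * x i ≤ 1 := by
    rw [← inner_intVec_single]
    exact hx (Pi.single i (s : ℤ), 1) (mem_cubeSystem_iff.2 ⟨i, s, rfl⟩)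
  rw [Set.mem_preimage, mem_closedBall_zero_iff, pi_norm_le_iff_of_nonneg zero_le_one]
  refine fun i => abs_le'.2 ⟨?_, ?_⟩
  · simpa using hle i 1
  · simpa using hle i (-1)

theorem isUnimodularFamily_tightSets_cubeSystem :
    IsUnimodularFamily (Fin n) (tightSets (cubeSystem n)) := by
  classical
  rintro _ ⟨x, -, rfl⟩
  let s (i : Fin n) : ℤˣ := if x i = 1 then 1 else -1
  refine ⟨(Pi.basisFun ℤ (Fin n)).unitsSMul s, fun v hv => ?_⟩
  obtain ⟨i, t, ht⟩ := mem_cubeSystem_iff.1 hv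
  obtain ⟨rfl, htx⟩ := Prod.mk.inj ht
  rw [inner_intVec_single] at htx
  have hst : s i = t := by
    rcases Int.units_eq_one_or t with rfl | rfl
    · exact if_pos (by simpa using htx.symm)
    · refine if_neg fun hx => ?_
      norm_num [hx] at htx
  refine ⟨i, ?_⟩
  rw [Module.Basis.unitsSMul_apply, hst, Pi.basisFun_apply, Units.smul_def, ← Pi.single_smul,
    smul_eq_mul, mul_one]

theorem isSmoothSystem_cubeSystem (n : ℕ) : IsSmoothSystem (cubeSystem n) where
  isBounded := isBounded_polyhedron_cubeSystem
  exists_forall_lt := by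
    refine ⟨0, fun a ha => ?_⟩
    obtain ⟨i, s, rfl⟩ := mem_cubeSystem_iff.1 ha
    rw [inner_zero_right]
    exact one_pos
  isUnimodularFamily := isUnimodularFamily_tightSets_cubeSystem

end Cube

section CommonRefinement

variable {n : ℕ} {A : Finset ((Fin n → ℤ) × ℝ)}

theorem isStellarClass_tightSets_isSmoothSystem (n : ℕ) :
    IsStellarClass (tightSets '' {A : Finset ((Fin n → ℤ) × ℝ) | IsSmoothSystem A}) where
  finite_sUnion := by
    rintro _ ⟨A, -, rfl⟩
    refine (A.finite_toSet.image Prod.fst).subset (Set.sUnion_subset ?_)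
    rintro _ ⟨x, -, rfl⟩
    exact tightNormals_subset_image_fst A x
  exists_isStellarSubdivision := by
    rintro _ ⟨A, hA, rfl⟩ S hS u hu w hw huw
    obtain ⟨A', hA', hsub⟩ := hA.exists_isStellarSubdivision hS hu hw huw
    exact ⟨_, ⟨A', hA', rfl⟩, hsub⟩

theorem exists_isSmoothSystem_separatedPairs_eq_empty
    (T : Finset (Module.Dual ℤ (Fin n → ℤ))) :
    ∃ A : Finset ((Fin n → ℤ) × ℝ), IsSmoothSystem A ∧
      ∀ φ ∈ T, separatedPairs (tightSets A) φ = ∅ := by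
  obtain ⟨_, ⟨A, hA, rfl⟩, hT⟩ :=
    (isStellarClass_tightSets_isSmoothSystem n).exists_forall_separatedPairs_eq_empty
      ⟨_, cubeSystem n, isSmoothSystem_cubeSystem n, rfl⟩ T
  exact ⟨A, hA, hT⟩

theorem nonneg_of_sum_nonneg_of_separatedPairs_eq_empty {M : Type*} [AddCommGroup M]
    {Δ : Set (Set M)} {φ : Module.Dual ℤ M} (hφ : separatedPairs Δ φ = ∅) {S : Finset M}
    (hS : ↑S ∈ Δ) (hsum : 0 ≤ φ (∑ v ∈ S, v)) {v : M} (hv : v ∈ S) : 0 ≤ φ v := by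
  by_contra! hneg
  have hnonpos : ∀ a ∈ S, φ a ≤ 0 := fun a ha => not_lt.1 fun hpos =>
    Set.eq_empty_iff_forall_notMem.1 hφ (a, v) ⟨⟨S, hS, ha, hv⟩, hpos, hneg⟩
  rw [map_sum] at hsum
  exact hsum.not_gt (Finset.sum_neg' hnonpos ⟨v, hv, hneg⟩)

theorem IsDelzant.exists_dirRefines_of_separatedPairs_eq_empty {P : Set (EucSp n)}
    (hP : IsDelzant P) :
    ∃ T : Finset (Module.Dual ℤ (Fin n → ℤ)), ∀ A, IsSmoothSystem A →
      (∀ φ ∈ T, separatedPairs (tightSets A) φ = ∅) → DirRefines (polyhedron A) P := by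
  classical
  choose! T hT using fun C hC => (hP.unimodular C hC).exists_eq_setOf_dualVec
  refine ⟨hP.isPolytope.finite_normalFan.toFinset.biUnion T, fun A hA hsep α β => ?_⟩
  rintro ⟨x, hxα, hxβ⟩
  have hx := hxα.1
  -- If a cone of the fan of `P` contains the sum of the normals tight at `x`, it contains each.
  let S := (finite_tightNormals A x).toFinset
  have hcoe : (S : Set (Fin n → ℤ)) = tightNormals A x := Set.Finite.coe_toFinset _
  set C := normalConeAt P (faceDir P (intVec (∑ v ∈ S, v)))
  have hC : C ∈ normalFan P := ⟨_, ⟨_, rfl⟩, rfl⟩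
  have hsum : intVec (∑ v ∈ S, v) ∈ C := fun p hp => hp
  have hmem : ∀ v ∈ tightNormals A x, intVec v ∈ C := fun v hv => by
    rw [hT C hC] at hsum ⊢
    intro φ hφ
    have hφsum := hsum φ hφ
    rw [inner_dualVec_intVec, Int.cast_nonneg_iff] at hφsum ⊢
    have hφsep := hsep φ (Finset.mem_biUnion.2 ⟨C, (Set.Finite.mem_toFinset _).2 hC, hφ⟩)
    exact nonneg_of_sum_nonneg_of_separatedPairs_eq_empty hφsep (hcoe ▸ ⟨x, hx, rfl⟩) hφsum
      (Finset.mem_coe.1 (hcoe ▸ hv))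
  obtain ⟨p, hp⟩ := hP.isPolytope.faceDir_nonempty (intVec (∑ v ∈ S, v))
  have htight : ∀ v ∈ intVec '' tightNormals A x, p ∈ faceDir P v :=
    Set.forall_mem_image.2 fun v hv => hmem v hv hp
  exact ⟨p, mem_faceDir_of_mem_hull hp.1 htight ((hA.mem_faceDir_iff hx).1 hxα),
    mem_faceDir_of_mem_hull hp.1 htight ((hA.mem_faceDir_iff hx).1 hxβ)⟩

theorem exists_isDelzant_forall_dirRefines {F : Set (Set (EucSp n))} (hF : F.Finite)
    (h : ∀ P ∈ F, IsDelzant P) : ∃ R, IsDelzant R ∧ ∀ P ∈ F, DirRefines R P := by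
  classical
  choose! T hT using fun P hP => (h P hP).exists_dirRefines_of_separatedPairs_eq_empty
  obtain ⟨A, hA, hsep⟩ := exists_isSmoothSystem_separatedPairs_eq_empty (hF.toFinset.biUnion T)
  exact ⟨polyhedron A, hA.isDelzant, fun P hP => hT P hP A hA fun φ hφ =>
    hsep φ (Finset.mem_biUnion.2 ⟨P, hF.mem_toFinset.2 hP, hφ⟩)⟩

end CommonRefinement

section MinkowskiSegments

open scoped Pointwise

variable {E : Type*} [NormedAddCommGroup E] [NormedSpace ℝ E]

/-- The Minkowski combination `(1 - s) K + s L`, the point at time `s` of the segment from `K`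
to `L` in the space of nonempty compact sets. -/
noncomputable def minkowskiComb (s : I) (K L : NonemptyCompacts E) : NonemptyCompacts E :=
  (K ×ˢ L).map (fun z => (1 - s : ℝ) • z.1 + (s : ℝ) • z.2) (by fun_prop)

theorem coe_minkowskiComb (s : I) (K L : NonemptyCompacts E) :
    (minkowskiComb s K L : Set E) = (1 - s : ℝ) • (K : Set E) + (s : ℝ) • (L : Set E) := by
  rw [minkowskiComb, NonemptyCompacts.coe_map, NonemptyCompacts.coe_prod, ← Set.image2_add,
    ← Set.image_smul, ← Set.image_smul, Set.image2_image_left, Set.image2_image_right]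
  exact Set.image_prod fun p q => (1 - s : ℝ) • p + (s : ℝ) • q

theorem minkowskiComb_zero (K L : NonemptyCompacts E) : minkowskiComb 0 K L = K := by
  refine SetLike.coe_injective ?_
  rw [coe_minkowskiComb, Set.Icc.coe_zero, sub_zero, one_smul, Set.zero_smul_set L.nonempty,
    add_zero]

theorem minkowskiComb_symm (s : I) (K L : NonemptyCompacts E) :
    minkowskiComb (unitInterval.symm s) K L = minkowskiComb s L K := by
  refine SetLike.coe_injective ?_
  rw [coe_minkowskiComb, coe_minkowskiComb, unitInterval.coe_symm_eq, sub_sub_cancel, add_comm]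

theorem minkowskiComb_one (K L : NonemptyCompacts E) : minkowskiComb 1 K L = L := by
  rw [← unitInterval.symm_zero, minkowskiComb_symm, minkowskiComb_zero]

theorem continuous_minkowskiComb :
    Continuous fun z : I × NonemptyCompacts E × NonemptyCompacts E =>
      minkowskiComb z.1 z.2.1 z.2.2 := by
  refine Continuous.nonemptyCompacts_map'
    (f := fun z : I × NonemptyCompacts E × NonemptyCompacts E => z.2.1 ×ˢ z.2.2)
    (g := fun z y => (1 - z.1 : ℝ) • y.1 + (z.1 : ℝ) • y.2)
    (NonemptyCompacts.continuous_prod.comp continuous_snd) ?_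
  unfold Function.uncurry
  fun_prop

theorem isSimplyConnected_of_minkowskiComb_mem {S : Set (NonemptyCompacts E)}
    {C : NonemptyCompacts E} (hC : C ∈ S) (h : ∀ K ∈ S, ∀ s, minkowskiComb s K C ∈ S) :
    IsSimplyConnected S := by
  have hcont : Continuous fun z : I × S => minkowskiComb z.1 z.2 C :=
    continuous_minkowskiComb.comp (f := fun z : I × S => (z.1, z.2.1, C)) (by fun_prop)
  have hhom : (ContinuousMap.id S).Homotopic (ContinuousMap.const S ⟨C, hC⟩) :=
    ⟨⟨⟨fun z => ⟨minkowskiComb z.1 z.2 C, h _ z.2.2 _⟩, hcont.subtype_mk _⟩,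
      fun K => Subtype.ext (minkowskiComb_zero _ _), fun K => Subtype.ext (minkowskiComb_one _ _)⟩⟩
  have : ContractibleSpace S := (contractible_iff_id_nullhomotopic S).2 ⟨⟨C, hC⟩, hhom⟩
  exact SimplyConnectedSpace.ofContractible S

end MinkowskiSegments

section RefinementStars

variable {n : ℕ}

theorem IsDelzant.minkowskiComb {K L : NonemptyCompacts (EucSp n)}
    (hK : IsDelzant (K : Set (EucSp n))) (hL : IsDelzant (L : Set (EucSp n)))
    (h : DirRefines (L : Set (EucSp n)) K) (s : I) :
    IsDelzant (minkowskiComb s K L : Set (EucSp n)) := by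
  rcases s.2.1.eq_or_lt with hs | hs
  · rwa [show s = 0 from Subtype.ext hs.symm, minkowskiComb_zero]
  · rw [coe_minkowskiComb]
    exact (hL.smul_set hs).add_left (hK.isPolytope.smul_set _)
      (((dirRefines_smul_set_left_iff hs).2 h).smul_set (sub_nonneg.2 s.2.2))

theorem DirRefines.minkowskiComb_left {K L : NonemptyCompacts (EucSp n)} {P : Set (EucSp n)}
    (hK : DirRefines (K : Set (EucSp n)) P) (hL : DirRefines (L : Set (EucSp n)) P) (s : I) :
    DirRefines (minkowskiComb s K L : Set (EucSp n)) P := by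
  rcases s.2.1.eq_or_lt with hs | hs
  · rwa [show s = 0 from Subtype.ext hs.symm, minkowskiComb_zero]
  · rw [coe_minkowskiComb]
    exact (dirRefines_add_right _ _).trans ((dirRefines_smul_set_left_iff hs).2 hL)

theorem DirRefines.minkowskiComb_right {K L : NonemptyCompacts (EucSp n)} {R : Set (EucSp n)}
    (hK : DirRefines R K) (hL : DirRefines R L) (s : I) :
    DirRefines R (minkowskiComb s K L : Set (EucSp n)) := by
  rw [coe_minkowskiComb]
  exact (hK.smul_set (sub_nonneg.2 s.2.2)).add (hL.smul_set s.2.1)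

namespace DelzantSpace

theorem isSimplyConnected_of_minkowskiComb_mem {S : Set (DelzantSpace n)} {C : DelzantSpace n}
    (hC : C ∈ S) (h : ∀ P ∈ S, ∀ s, ∃ Q ∈ S, Q.1 = minkowskiComb s P.1 C.1) :
    IsSimplyConnected S := by
  rw [← Topology.IsEmbedding.subtypeVal.isSimplyConnected_image]
  refine _root_.isSimplyConnected_of_minkowskiComb_mem (Set.mem_image_of_mem _ hC) ?_
  rintro _ ⟨P, hP, rfl⟩ s
  exact h P hP s

/-- The Delzant polytopes whose fan refines that of `C`. -/
def refinementsOf (C : DelzantSpace n) : Set (DelzantSpace n) :=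
  {P | DirRefines (P.1 : Set (EucSp n)) C.1}

/-- The Delzant polytopes whose fan is refined by that of `R`. -/
def refinedBy (R : DelzantSpace n) : Set (DelzantSpace n) :=
  {P | DirRefines (R.1 : Set (EucSp n)) P.1}

theorem isSimplyConnected_refinementsOf (C : DelzantSpace n) :
    IsSimplyConnected (refinementsOf C) := by
  refine isSimplyConnected_of_minkowskiComb_mem (DirRefines.refl _) fun P hP s => ?_
  have hdelzant := C.2.minkowskiComb P.2 hP (unitInterval.symm s)
  rw [minkowskiComb_symm] at hdelzant
  exact ⟨⟨_, hdelzant⟩, DirRefines.minkowskiComb_left hP (DirRefines.refl _) s, rfl⟩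

theorem isSimplyConnected_refinedBy (R : DelzantSpace n) : IsSimplyConnected (refinedBy R) :=
  isSimplyConnected_of_minkowskiComb_mem (DirRefines.refl _) fun P hP s =>
    ⟨⟨_, P.2.minkowskiComb R.2 hP s⟩, DirRefines.minkowskiComb_right hP (DirRefines.refl _) s, rfl⟩

theorem isSimplyConnected_refinementsOf_inter_refinedBy {C R : DelzantSpace n}
    (h : R ∈ refinementsOf C) : IsSimplyConnected (refinementsOf C ∩ refinedBy R) :=
  isSimplyConnected_of_minkowskiComb_mem ⟨h, DirRefines.refl _⟩ fun P hP s =>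
    ⟨⟨_, P.2.minkowskiComb R.2 hP.2 s⟩, ⟨DirRefines.minkowskiComb_left hP.1 h s,
      DirRefines.minkowskiComb_right hP.2 (DirRefines.refl _) s⟩, rfl⟩

theorem fanRefines_iff_mem_refinementsOf {P C : DelzantSpace n} :
    FanRefines P.fan C.fan ↔ P ∈ refinementsOf C :=
  fanRefines_normalFan_iff_dirRefines P.2.isPolytope C.2.isPolytope

theorem exists_forall_mem_refinedBy {F : Set (DelzantSpace n)} (hF : F.Finite) :
    ∃ R, ∀ P ∈ F, P ∈ refinedBy R := by
  obtain ⟨R, hR, hRF⟩ := exists_isDelzant_forall_dirRefines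
    (hF.image fun P => (P.1 : Set (EucSp n))) (Set.forall_mem_image.2 fun P _ => P.2)
  exact ⟨⟨⟨⟨R, hR.isPolytope.isCompact⟩, hR.isPolytope.nonempty⟩, hR⟩,
    fun P hP => hRF _ (Set.mem_image_of_mem _ hP)⟩

theorem isClosed_refinedBy (R : DelzantSpace n) : IsClosed (refinedBy R) :=
  (isClosed_setOf_dirRefines _).preimage continuous_subtype_val

end DelzantSpace

end RefinementStars

section PathReplacement

variable {X : Type*} [TopologicalSpace X] {x y : X} {U V : Set X}

theorem homotopic_of_isSimplyConnected (hU : IsSimplyConnected U) {p q : Path x y}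
    (hp : ∀ s, p s ∈ U) (hq : ∀ s, q s ∈ U) : p.Homotopic q := by
  have := hU.simplyConnectedSpace
  obtain ⟨hx, hy⟩ : x ∈ U ∧ y ∈ U := ⟨p.source ▸ hp 0, p.target ▸ hp 1⟩
  let lift (r : Path x y) (hr : ∀ s, r s ∈ U) : Path (⟨x, hx⟩ : U) ⟨y, hy⟩ :=
    ⟨⟨fun s => ⟨r s, hr s⟩, by fun_prop⟩, Subtype.ext r.source, Subtype.ext r.target⟩
  exact (SimplyConnectedSpace.paths_homotopic (lift p hp) (lift q hq)).map
    (ContinuousMap.mk Subtype.val)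

theorem exists_homotopic_forall_mem (hU : IsSimplyConnected U) (hUV : IsPathConnected (U ∩ V))
    {p : Path x y} (hp : ∀ s, p s ∈ U) (hx : x ∈ V) (hy : y ∈ V) :
    ∃ q : Path x y, p.Homotopic q ∧ ∀ s, q s ∈ V := by
  obtain ⟨q, hq⟩ := hUV.joinedIn x ⟨p.source ▸ hp 0, hx⟩ y ⟨p.target ▸ hp 1, hy⟩
  exact ⟨q, homotopic_of_isSimplyConnected hU hp fun s => (hq s).1, fun s => (hq s).2⟩

variable {γ : Path x y} {t : ℕ → I} {N : ℕ} {W : ℕ → Set X}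

theorem exists_homotopic_subpath_forall_mem (ht : Monotone t)
    (hW : ∀ k < N, IsSimplyConnected (W k)) (hWV : ∀ k < N, IsPathConnected (W k ∩ V))
    (hγW : ∀ k < N, ∀ s ∈ Set.Icc (t k) (t (k + 1)), γ s ∈ W k) (hγV : ∀ k ≤ N, γ (t k) ∈ V) :
    ∀ k ≤ N, ∃ δ : Path (γ (t 0)) (γ (t k)),
      (γ.subpath (t 0) (t k)).Homotopic δ ∧ ∀ s, δ s ∈ V := fun k => by
  induction k with
  | zero => exact fun _ => ⟨Path.refl _, γ.subpath_self _ ▸ .refl _, fun _ => hγV 0 N.zero_le⟩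
  | succ k ih =>
    intro hk
    obtain ⟨δ, hδ, hδV⟩ := ih (Nat.le_of_succ_le hk)
    have hpiece : ∀ s, γ.subpath (t k) (t (k + 1)) s ∈ W k := Set.forall_mem_range.1 <| by
      rw [γ.range_subpath_of_le _ _ (ht k.le_succ)]
      exact Set.forall_mem_image.2 (hγW k hk)
    obtain ⟨ε, hε, hεV⟩ := exists_homotopic_forall_mem (hW k hk) (hWV k hk) hpiece
      (hγV k (Nat.le_of_succ_le hk)) (hγV (k + 1) hk)
    have hsplit : ((γ.subpath (t 0) (t k)).trans (γ.subpath (t k) (t (k + 1)))).Homotopic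
        (γ.subpath (t 0) (t (k + 1))) := ⟨Path.Homotopy.subpathTransSubpath γ _ _ _⟩
    refine ⟨δ.trans ε, hsplit.symm.trans (hδ.hcomp hε), Set.forall_mem_range.1 ?_⟩
    rw [Path.trans_range]
    exact Set.union_subset (Set.range_subset_iff.2 hδV) (Set.range_subset_iff.2 hεV)

theorem exists_homotopic_forall_mem_of_monotone (ht : Monotone t) (ht₀ : t 0 = 0) (htN : t N = 1)
    (hW : ∀ k < N, IsSimplyConnected (W k)) (hWV : ∀ k < N, IsPathConnected (W k ∩ V))
    (hγW : ∀ k < N, ∀ s ∈ Set.Icc (t k) (t (k + 1)), γ s ∈ W k) (hγV : ∀ k ≤ N, γ (t k) ∈ V) :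
    ∃ δ : Path x y, γ.Homotopic δ ∧ ∀ s, δ s ∈ V := by
  have hsub := exists_homotopic_subpath_forall_mem ht hW hWV hγW hγV N le_rfl
  rw [ht₀, htN, γ.subpath_zero_one] at hsub
  obtain ⟨δ, hδ, hδV⟩ := hsub
  exact ⟨δ.cast γ.source.symm γ.target.symm, hδ, hδV⟩

end PathReplacement

section LocallyRefiningPaths

variable {n : ℕ} {P Q : DelzantSpace n} {γ δ : Path P Q}

open DelzantSpace

theorem isLocallyRefining_iff_eventually :
    IsLocallyRefining γ ↔ ∀ t₀, ∀ᶠ t in nhds t₀, γ t ∈ refinementsOf (γ t₀) := by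
  refine forall_congr' fun t₀ => ?_
  simp only [Metric.nhds_basis_closedBall.eventually_iff, Metric.mem_closedBall, Subtype.dist_eq,
    Real.dist_eq, fanRefines_iff_mem_refinementsOf]

theorem isLocallyRefining_refl (P : DelzantSpace n) : IsLocallyRefining (Path.refl P) :=
  isLocallyRefining_iff_eventually.2 fun _ => Filter.Eventually.of_forall fun _ =>
    DirRefines.refl _

theorem IsLocallyRefining.exists_finite_forall_refinedBy (hγ : IsLocallyRefining γ) :
    ∃ F : Set (DelzantSpace n), F.Finite ∧ ∀ R, (∀ C ∈ F, C ∈ refinedBy R) →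
      ∃ δ : Path P Q, γ.Homotopic δ ∧ ∀ s, δ s ∈ refinedBy R := by
  choose O hO hOopen hmem using fun t₀ =>
    eventually_nhds_iff.1 (isLocallyRefining_iff_eventually.1 hγ t₀)
  obtain ⟨t, ht₀, ht, ⟨N, hN⟩, hcover⟩ := exists_monotone_Icc_subset_open_cover_unitInterval
    hOopen fun s _ => Set.mem_iUnion.2 ⟨s, hmem s⟩
  choose τ hτ using hcover
  refine ⟨(γ ∘ t) '' Set.Iic N ∪ (γ ∘ τ) '' Set.Iic N,
    ((Set.finite_Iic N).image _).union ((Set.finite_Iic N).image _), fun R hR => ?_⟩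
  have hRt : ∀ k ≤ N, γ (t k) ∈ refinedBy R := fun k hk => hR _ (Or.inl ⟨k, hk, rfl⟩)
  have hRτ : ∀ k ≤ N, R ∈ refinementsOf (γ (τ k)) := fun k hk => hR _ (Or.inr ⟨k, hk, rfl⟩)
  exact exists_homotopic_forall_mem_of_monotone ht ht₀ (hN N le_rfl)
    (W := fun k => refinementsOf (γ (τ k)))
    (fun k _ => isSimplyConnected_refinementsOf _)
    (fun k hk => (isSimplyConnected_refinementsOf_inter_refinedBy (hRτ k hk.le)).isPathConnected)
    (fun k _ s hs => hO _ s (hτ k hs)) hRt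

theorem IsLocallyRefining.homotopic (hγ : IsLocallyRefining γ) (hδ : IsLocallyRefining δ) :
    γ.Homotopic δ := by
  obtain ⟨F, hF, hFγ⟩ := hγ.exists_finite_forall_refinedBy
  obtain ⟨G, hG, hGδ⟩ := hδ.exists_finite_forall_refinedBy
  obtain ⟨R, hR⟩ := exists_forall_mem_refinedBy (hF.union hG)
  obtain ⟨γ', hγγ', hγ'⟩ := hFγ R fun C hC => hR C (Or.inl hC)
  obtain ⟨δ', hδδ', hδ'⟩ := hGδ R fun C hC => hR C (Or.inr hC)
  exact hγγ'.trans <|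
    (homotopic_of_isSimplyConnected (isSimplyConnected_refinedBy R) hγ' hδ').trans hδδ'.symm

theorem HasFiniteComplexity.isLocallyRefining (hγ : HasFiniteComplexity γ) :
    IsLocallyRefining γ := by
  refine isLocallyRefining_iff_eventually.2 fun t₀ => ?_
  have hfan : ∀ S ∈ Set.range fun t => (γ t).fan,
      ∀ᶠ t in nhds t₀, (γ t).fan = S → FanRefines S (γ t₀).fan := by
    rintro _ ⟨t₁, rfl⟩
    by_cases ht : γ t₀ ∈ refinedBy (γ t₁)
    · exact Filter.Eventually.of_forall fun _ _ => fanRefines_iff_mem_refinementsOf.2 ht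
    · filter_upwards [γ.continuous.continuousAt.eventually_mem
        ((isClosed_refinedBy (γ t₁)).isOpen_compl.mem_nhds ht)] with t htt₁ heq
      have hrefl : FanRefines (γ t₁).fan (γ t).fan := heq ▸ fun C hC => ⟨C, hC, subset_rfl⟩
      exact absurd (fanRefines_iff_mem_refinementsOf.1 hrefl) htt₁
  filter_upwards [(Filter.eventually_all_finite hγ).2 hfan] with t ht
  exact fanRefines_iff_mem_refinementsOf.1 (ht _ ⟨t, rfl⟩ rfl)

end LocallyRefiningPaths

theorem mainTheorem8_general {n : ℕ} {P Q : DelzantSpace n} (γ : Path P Q) :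
    (IsLocallyRefining γ → ∀ δ : Path P Q, IsLocallyRefining δ → Path.Homotopic γ δ) ∧
      (HasFiniteComplexity γ → IsLocallyRefining γ) :=
  ⟨fun hγ _ hδ => hγ.homotopic hδ, fun hγ => hγ.isLocallyRefining⟩

theorem mainTheorem8 (n : ℕ) (P : DelzantSpace n) (γ : Path P P) :
    (IsLocallyRefining γ → Path.Homotopic γ (Path.refl P)) ∧
      (HasFiniteComplexity γ → IsLocallyRefining γ) :=
  ⟨fun hγ => (mainTheorem8_general γ).1 hγ _ (isLocallyRefining_refl P), (mainTheorem8_general γ).2⟩
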